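/- Let $(B_t)_{t\ge 0}$ be a standard one-dimensional Brownian motion with $B_0=0$ on a probability space. For $a>0$ and $x\ge 0$ put $$u^a(x)=\sqrt{\tfrac{2}{\pi}}\int_0^{x/\sqrt a}e^{-y^2/2}\,dy ,$$ and consider, for $a>0$ and $x\ge 0$, the equation on the half line $$X^a_t(x)=x+B_t+\int_0^t \partial_x\ln u^a\big(X^a_s(x)\big)\,ds .\qquad (*)$$ Here a solution on a time interval $[0,\zeta)$, $0\le\zeta\le\infty$, is a continuous path with values in $[0,\infty)$ that is strictly positive at Lebesgue-almost every time, for which the integrand is integrable on $[0,t]$ for every $t<\zeta$ and $(*)$ holds for every $t<\zeta$. (i) For every $\omega$: if $0<a\le a'$ and $0\le x\le y$, then any solution of $(*)$ on $[0,\zeta)$ with data $(a,x)$ is at most any solution on $[0,\zeta)$ with data $(a',y)$, at every time $t<\zeta$; and if solutions $X^a_\cdot(x)$ on $[0,\infty)$ are given for all $a>0$, then $\lim_{a\downarrow 0}X^a_t(x)$ exists for every $t$. (ii) There are processes $X^a_t(x)$, $a>0$, $x\ge 0$, adapted to the completed filtration of $B$, such that for almost every $\omega$ the following hold simultaneously for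 all $a>0$, $x\ge 0$ and $t\ge 0$: - $X^a_\cdot(x)$ is a solution of $(*)$ on $[0,\infty)$, and every solution of $(*)$ on an interval $[0,\zeta)$ coincides with it on $[0,\zeta)$; - $X^a_t(x)$ never hits $0$: $X^a_t(x)>0$ whenever $x>0$ or $t>0$; - $x\mapsto X^a_t(x)$ is strictly increasing on $[0,\infty)$, and $X^a_t(x)$ decreases (in the weak sense) as $a$ decreases to $0$; - there is a unique pair $(X_\cdot(x),L_\cdot(x))$ solving the Skorohod problem for $x+B$, that is, $X_t(x)=x+B_t+L_t(x)\ge 0$ for all $t$, where $L_\cdot(x)$ is continuous and nondecreasing, $L_0(x)=0$ and $\int_0^t \mathbf 1_{\{X_s(x)=0\}}\,dL_s(x)=L_t(x)$ for all $t$; and $\lim_{a\downarrow 0}X^a_t(x)=X_t(x)$ for all $t$; - the limit process is not $|x+B|$: there is a time $s$ with $X_s(x)\ne |x+B_s|$. -/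

import Mathlib

open MeasureTheory ProbabilityTheory Filter Topology
open scoped NNReal ENNReal

noncomputable section

/-- The function `u^a(x) = √(2/π) ∫_0^{x/√a} exp(-y²/2) dy`, for `a > 0`. -/
def halfLineU (a x : ℝ) : ℝ :=
  √(2 / Real.pi) * ∫ y in (0 : ℝ)..(x / √a), Real.exp (-(y ^ 2) / 2)

/-- The drift `∂_x ln u^a (x)`; it is only used for `a > 0` and `x > 0`, where it is genuinely
a derivative of a smooth function. -/
def halfLineDrift (a x : ℝ) : ℝ :=
  deriv (fun y => Real.log (halfLineU a y)) x

/-- `X` is a solution on the time interval `[0, ζ)` of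
`X_t = x + w_t + ∫_0^t ∂_x ln u^a (X_s) ds` in the closed half line.
The solution is not required to stay away from `0`: since the drift is defined on `(0, ∞)` only,
it is required to be in `(0, ∞)` at almost every time, so that the integral makes sense. -/
structure IsHalfLineSolution (a x : ℝ) (w : ℝ≥0 → ℝ) (ζ : ℝ≥0∞) (X : ℝ≥0 → ℝ) : Prop where
  continuousOn : ContinuousOn X {t : ℝ≥0 | (t : ℝ≥0∞) < ζ}
  nonneg : ∀ t : ℝ≥0, (t : ℝ≥0∞) < ζ → 0 ≤ X t
  ae_pos : ∀ᵐ s : ℝ, 0 ≤ s → ENNReal.ofReal s < ζ → 0 < X s.toNNReal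
  intervalIntegrable : ∀ t : ℝ≥0, (t : ℝ≥0∞) < ζ →
    IntervalIntegrable (fun s : ℝ => halfLineDrift a (X s.toNNReal)) volume 0 t
  eq : ∀ t : ℝ≥0, (t : ℝ≥0∞) < ζ →
    X t = x + w t + ∫ s in (0 : ℝ)..t, halfLineDrift a (X s.toNNReal)

/-- `(g, h)` solves the Skorohod problem on the half line associated with `(x, f)`:
`g = x + f + h ≥ 0`, where `h` is continuous, nondecreasing, starts from `0`, and satisfies
`∫_0^t 1_{g(s) = 0} dh(s) = h(t)`. The measure `dh` is the Lebesgue-Stieltjes measure of `h`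
(extended by `h(0)` to negative times). -/
structure IsSkorohodSolution (x : ℝ) (f g h : ℝ≥0 → ℝ) : Prop where
  eq : ∀ t, g t = x + f t + h t
  nonneg : ∀ t, 0 ≤ g t
  continuous : Continuous h
  monotone : Monotone h
  zero : h 0 = 0
  integral_eq : ∃ H : StieltjesFunction ℝ, (∀ s : ℝ, H s = h s.toNNReal) ∧
    ∀ t : ℝ≥0, ∫ s in Set.Ioc (0 : ℝ) t,
      Set.indicator {r : ℝ | g r.toNNReal = 0} (fun _ => (1 : ℝ)) s ∂H.measure = h t

end

/-! Write `b_a` for the drift. It is the inverse of the integral of `exp ((z² - y²) / (2a))` over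
`y` in `[0, z]`. Hence it is nonincreasing in `z`, nondecreasing in `a`, at most `1/z` and `3a/z³`,
and at least `1/z - z/(2a)`. Two solutions driven by the same path have a noise-free difference,
which by this monotonicity cannot increase while it has the wrong sign (`halfLine_comparison`). This
gives part (i), uniqueness and weak monotonicity for each path separately.

Global existence and positivity use probability. Near `0` the equation resembles that of the
three-dimensional Bessel process, and `1/z` along a solution is a supermartingale up to the factor
`exp (t/(2a))`. The proof carries this out on Euler schemes frozen below `2ε`: a Taylor expansion of
`1/z`, a discrete Gronwall inequality and Markov's inequality show that the scheme ends below `2ε`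
with probability `O(ε)` as the mesh vanishes (`measureReal_halfLineEuler_lt_le`). Countably many
data suffice to place almost every path in the deterministic class `IsNonHittingPath`. For such a
path all `a`, `x` and `t` are treated at once: comparison passes to larger data, the start at `x ≥
0` is a decreasing limit of positive solutions (`isGlobalSolution_of_tendsto`), and restarting at
rational times gives positivity.

For the limit in `a`, a Skorohod solution `g` satisfies `g ≤ X^a ≤ g + δ + b_a(δ) t` for every `δ >
0`, and `b_a(δ) ≤ 3a/δ³`. This also proves uniqueness for the Skorohod problem. The limit is not `|x
+ B|`, since its pushing term would have to return to `0` after an excursion of `x + B` below `0`;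
such a return occurs because `B` is unbounded on both sides. Adaptedness holds because the solution
is an iterated limit of Euler schemes. -/

noncomputable section

/-! ### Estimates for the drift -/

/-- The denominator of the drift of the half-line equation. -/
def gaussianMass (a z : ℝ) : ℝ := ∫ y in (0 : ℝ)..z, Real.exp (-(y ^ 2) / (2 * a))

lemma continuous_gaussianMass_integrand (a : ℝ) :
    Continuous fun y : ℝ => Real.exp (-(y ^ 2) / (2 * a)) := by fun_prop

lemma hasDerivAt_gaussianMass (a z : ℝ) :
    HasDerivAt (gaussianMass a) (Real.exp (-(z ^ 2) / (2 * a))) z :=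
  intervalIntegral.integral_hasDerivAt_right
    ((continuous_gaussianMass_integrand a).intervalIntegrable _ _)
    ((continuous_gaussianMass_integrand a).stronglyMeasurableAtFilter _ _)
    (continuous_gaussianMass_integrand a).continuousAt

lemma gaussianMass_pos {a z : ℝ} (hz : 0 < z) : 0 < gaussianMass a z :=
  intervalIntegral.intervalIntegral_pos_of_pos
    ((continuous_gaussianMass_integrand a).intervalIntegrable _ _) (fun _ => Real.exp_pos _) hz

lemma halfLineU_eq {a : ℝ} (ha : 0 < a) (x : ℝ) :
    halfLineU a x = √(2 / Real.pi) * ((√a)⁻¹ * gaussianMass a x) := by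
  have hs : 0 < √a := Real.sqrt_pos.2 ha
  have h := intervalIntegral.inv_mul_integral_comp_div (a := 0) (b := x)
    (f := fun y : ℝ => Real.exp (-(y ^ 2) / 2)) (√a)
  unfold halfLineU gaussianMass
  rw [zero_div] at h
  rw [← h]
  congr 3
  ext y
  congr 1
  rw [div_pow, Real.sq_sqrt ha.le]
  field_simp

lemma halfLineDrift_eq_div {a z : ℝ} (ha : 0 < a) (hz : 0 < z) :
    halfLineDrift a z = Real.exp (-(z ^ 2) / (2 * a)) / gaussianMass a z := by
  have hs : 0 < √a := Real.sqrt_pos.2 ha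
  have hc : 0 < √(2 / Real.pi) := Real.sqrt_pos.2 (by positivity)
  have hm := gaussianMass_pos (a := a) hz
  have h : HasDerivAt (fun y => Real.log (halfLineU a y))
      ((√(2 / Real.pi) * ((√a)⁻¹ * Real.exp (-(z ^ 2) / (2 * a)))) / halfLineU a z) z := by
    apply HasDerivAt.log
    · have := ((hasDerivAt_gaussianMass a z).const_mul (√a)⁻¹).const_mul √(2 / Real.pi)
      refine this.congr_of_eventuallyEq (Eventually.of_forall fun y => ?_)
      simp only [halfLineU_eq ha]
    · rw [halfLineU_eq ha]; positivity
  unfold halfLineDrift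
  rw [h.deriv, halfLineU_eq ha]
  field_simp

/-- For `0 ≤ y ≤ z` the exponent is nonnegative and decreases with the parameter. Monotonicity in
`a` and both upper bounds on the drift are read off from this form. -/
lemma halfLineDrift_eq_inv {a z : ℝ} (ha : 0 < a) (hz : 0 < z) :
    halfLineDrift a z = (∫ y in (0 : ℝ)..z, Real.exp ((z ^ 2 - y ^ 2) / (2 * a)))⁻¹ := by
  have h : ∫ y in (0 : ℝ)..z, Real.exp ((z ^ 2 - y ^ 2) / (2 * a)) =
      Real.exp (z ^ 2 / (2 * a)) * gaussianMass a z := by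
    unfold gaussianMass
    rw [← intervalIntegral.integral_const_mul]
    congr 1
    ext y
    rw [← Real.exp_add]
    congr 1
    ring
  rw [halfLineDrift_eq_div ha hz, h, mul_inv, ← Real.exp_neg, div_eq_mul_inv, neg_div]

lemma halfLineDrift_pos {a z : ℝ} (ha : 0 < a) (hz : 0 < z) : 0 < halfLineDrift a z := by
  rw [halfLineDrift_eq_div ha hz]
  exact div_pos (Real.exp_pos _) (gaussianMass_pos hz)

lemma halfLineDrift_anti {a y z : ℝ} (ha : 0 < a) (hy : 0 < y) (hyz : y ≤ z) :
    halfLineDrift a z ≤ halfLineDrift a y := by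
  rw [halfLineDrift_eq_div ha hy, halfLineDrift_eq_div ha (hy.trans_le hyz)]
  have hm : Monotone (gaussianMass a) := monotone_of_deriv_nonneg
    (fun x => (hasDerivAt_gaussianMass a x).differentiableAt)
    (fun x => by rw [(hasDerivAt_gaussianMass a x).deriv]; positivity)
  have h2 : -(z ^ 2) / (2 * a) ≤ -(y ^ 2) / (2 * a) := by gcongr
  exact div_le_div₀ (Real.exp_pos _).le (Real.exp_le_exp.2 h2) (gaussianMass_pos hy) (hm hyz)

lemma continuous_halfLineDrift_inv_integrand (a z : ℝ) :
    Continuous fun y : ℝ => Real.exp ((z ^ 2 - y ^ 2) / (2 * a)) := by fun_prop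

lemma halfLineDrift_mono_param {a a' z : ℝ} (ha : 0 < a) (haa' : a ≤ a') (hz : 0 < z) :
    halfLineDrift a z ≤ halfLineDrift a' z := by
  rw [halfLineDrift_eq_inv ha hz, halfLineDrift_eq_inv (ha.trans_le haa') hz]
  apply inv_anti₀
  · exact intervalIntegral.intervalIntegral_pos_of_pos
      ((continuous_halfLineDrift_inv_integrand a' z).intervalIntegrable _ _)
      (fun _ => Real.exp_pos _) hz
  · apply intervalIntegral.integral_mono_on hz.le
      ((continuous_halfLineDrift_inv_integrand a' z).intervalIntegrable _ _)
      ((continuous_halfLineDrift_inv_integrand a z).intervalIntegrable _ _)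
    intro y hy
    apply Real.exp_le_exp.2
    have : y ^ 2 ≤ z ^ 2 := by have := hy.1; have := hy.2; gcongr
    apply div_le_div_of_nonneg_left (by linarith) (by linarith) (by linarith)

lemma halfLineDrift_le_inv {a z : ℝ} (ha : 0 < a) (hz : 0 < z) :
    halfLineDrift a z ≤ z⁻¹ := by
  rw [halfLineDrift_eq_inv ha hz]
  apply inv_anti₀ hz
  calc z = ∫ _ in (0 : ℝ)..z, (1 : ℝ) := by simp
    _ ≤ _ := by
      apply intervalIntegral.integral_mono_on hz.le (by simp)
        ((continuous_halfLineDrift_inv_integrand a z).intervalIntegrable _ _)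
      intro y hy
      apply Real.one_le_exp
      have : y ^ 2 ≤ z ^ 2 := by have := hy.1; have := hy.2; gcongr
      exact div_nonneg (by linarith) (by linarith)

/-- In the quotient form, `exp (-u) ≥ 1 - u` bounds the numerator and `z` bounds the denominator.
The leading term `1/z` is exactly what makes `0` inaccessible. -/
lemma le_halfLineDrift {a z : ℝ} (ha : 0 < a) (hz : 0 < z) :
    z⁻¹ - z / (2 * a) ≤ halfLineDrift a z := by
  have h1 : gaussianMass a z ≤ z := by
    calc gaussianMass a z ≤ ∫ _ in (0 : ℝ)..z, (1 : ℝ) := by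
          apply intervalIntegral.integral_mono_on hz.le
            ((continuous_gaussianMass_integrand a).intervalIntegrable _ _) (by simp)
          intro y _
          apply Real.exp_le_one_iff.2
          exact div_nonpos_of_nonpos_of_nonneg (by nlinarith [sq_nonneg y]) (by linarith)
      _ = z := by simp
  rw [halfLineDrift_eq_div ha hz]
  calc z⁻¹ - z / (2 * a) = (1 - z ^ 2 / (2 * a)) / z := by field_simp
    _ ≤ Real.exp (-(z ^ 2) / (2 * a)) / z := by
      gcongr
      have := Real.add_one_le_exp (-(z ^ 2) / (2 * a))
      rw [neg_div] at this ⊢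
      linarith
    _ ≤ _ := by
      apply div_le_div_of_nonneg_left (Real.exp_pos _).le (gaussianMass_pos hz) h1

/-- From `exp u ≥ u` under the integral. The bound vanishes as `a ↓ 0` for fixed `z`, so in the
limit the drift acts only at `0`. -/
lemma halfLineDrift_le_mul {a z : ℝ} (ha : 0 < a) (hz : 0 < z) :
    halfLineDrift a z ≤ 3 * a / z ^ 3 := by
  rw [halfLineDrift_eq_inv ha hz, ← inv_div]
  apply inv_anti₀ (by positivity)
  calc z ^ 3 / (3 * a) = ∫ y in (0 : ℝ)..z, (z ^ 2 - y ^ 2) / (2 * a) := by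
        rw [intervalIntegral.integral_div, intervalIntegral.integral_sub (by simp)
          ((continuous_pow 2).intervalIntegrable _ _), integral_pow]
        simp
        field_simp
        ring
    _ ≤ _ := by
      apply intervalIntegral.integral_mono_on hz.le
        (Continuous.intervalIntegrable (by fun_prop) _ _)
        ((continuous_halfLineDrift_inv_integrand a z).intervalIntegrable _ _)
      intro y _
      have := Real.add_one_le_exp ((z ^ 2 - y ^ 2) / (2 * a))
      linarith

lemma hasDerivAt_halfLineDrift {a z : ℝ} (ha : 0 < a) (hz : 0 < z) :
    HasDerivAt (halfLineDrift a) (-(z / a * halfLineDrift a z + halfLineDrift a z ^ 2)) z := by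
  have hm := gaussianMass_pos (a := a) hz
  have h1 : HasDerivAt (fun y : ℝ => Real.exp (-(y ^ 2) / (2 * a)))
      (Real.exp (-(z ^ 2) / (2 * a)) * (-(2 * z) / (2 * a))) z := by
    have : HasDerivAt (fun y : ℝ => -(y ^ 2) / (2 * a)) (-(2 * z) / (2 * a)) z := by
      simpa using ((hasDerivAt_pow 2 z).neg).div_const (2 * a)
    exact this.exp
  have h2 := h1.div (hasDerivAt_gaussianMass a z) hm.ne'
  refine (h2.congr_of_eventuallyEq ?_).congr_deriv ?_
  · filter_upwards [Ioi_mem_nhds hz] with y hy using halfLineDrift_eq_div ha hy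
  · rw [halfLineDrift_eq_div ha hz]
    field_simp
    ring

lemma measurable_halfLineDrift (a : ℝ) : Measurable (halfLineDrift a) := measurable_deriv _

lemma abs_halfLineDrift_sub_le {a ε y z : ℝ} (ha : 0 < a) (hε : 0 < ε) (hy : ε ≤ y) (hz : ε ≤ z) :
    |halfLineDrift a y - halfLineDrift a z| ≤ (1 / a + 1 / ε ^ 2) * |y - z| := by
  have := (convex_Ici ε).norm_image_sub_le_of_norm_hasDerivWithin_le
    (f := halfLineDrift a) (C := 1 / a + 1 / ε ^ 2) (x := z) (y := y)
    (fun x hx => (hasDerivAt_halfLineDrift ha (hε.trans_le hx)).hasDerivWithinAt) ?_ hz hy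
  · simpa using this
  · intro x hx
    have hx0 : 0 < x := hε.trans_le hx
    have hp := halfLineDrift_pos ha hx0
    have hle := halfLineDrift_le_inv ha hx0
    rw [norm_neg, Real.norm_of_nonneg (by positivity)]
    have h1 : x / a * halfLineDrift a x ≤ x / a * x⁻¹ := by gcongr
    have h2 : x / a * x⁻¹ = 1 / a := by field_simp
    have h3 : halfLineDrift a x ≤ ε⁻¹ := hle.trans (inv_anti₀ hε hx)
    have h4 : halfLineDrift a x ^ 2 ≤ (ε⁻¹) ^ 2 := by gcongr
    rw [inv_pow, ← one_div] at h4
    linarith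

/-! ### Path equations and comparison -/

/-- A continuous function that cannot increase while it is positive stays nonpositive. -/
lemma nonpos_of_le_of_pos_Ioc {D : ℝ → ℝ} {T : ℝ} (hD : ContinuousOn D (Set.Icc 0 T))
    (h0 : D 0 ≤ 0)
    (h : ∀ s t, 0 ≤ s → s ≤ t → t ≤ T → (∀ r ∈ Set.Ioc s t, 0 < D r) → D t ≤ D s) :
    ∀ t ∈ Set.Icc 0 T, D t ≤ 0 := by
  intro t ht
  by_contra! hpos
  -- `sSup S` is the last time up to `t` at which `D ≤ 0`; strictly after it `D` is positive, so the
  -- half-open interval in the hypothesis is the right one.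
  set S : Set ℝ := Set.Icc 0 t ∩ D ⁻¹' Set.Iic 0 with hS
  have hDt : ContinuousOn D (Set.Icc 0 t) := hD.mono (Set.Icc_subset_Icc_right ht.2)
  have hclosed : IsClosed S := hDt.preimage_isClosed_of_isClosed isClosed_Icc isClosed_Iic
  have hne : S.Nonempty := ⟨0, ⟨le_rfl, ht.1⟩, h0⟩
  have hbdd : BddAbove S := ⟨t, fun r hr => hr.1.2⟩
  have hmem : sSup S ∈ S := hclosed.csSup_mem hne hbdd
  have hle := h (sSup S) t hmem.1.1 hmem.1.2 ht.2 fun r hr => by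
    by_contra! hr0
    exact (not_le.2 hr.1) (le_csSup hbdd ⟨⟨hmem.1.1.trans hr.1.le, hr.2⟩, hr0⟩)
  have : D (sSup S) ≤ 0 := hmem.2
  linarith

/-- `Y` is continuous on `[0, T]` and solves `Y_t = x + w_t + ∫_0^t b(Y_s) ds` there. -/
structure IsPathSolution (b : ℝ → ℝ) (x : ℝ) (w : ℝ → ℝ) (T : ℝ) (Y : ℝ → ℝ) : Prop where
  continuousOn : ContinuousOn Y (Set.Icc 0 T)
  intervalIntegrable : IntervalIntegrable (fun s => b (Y s)) volume 0 T
  eq : ∀ t ∈ Set.Icc 0 T, Y t = x + w t + ∫ s in (0 : ℝ)..t, b (Y s)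

namespace IsPathSolution

variable {b b' : ℝ → ℝ} {x x' T T' : ℝ} {w Y Y' : ℝ → ℝ}

lemma intervalIntegrable_of_le (h : IsPathSolution b x w T Y) {s t : ℝ} (hs : 0 ≤ s)
    (hst : s ≤ t) (ht : t ≤ T) : IntervalIntegrable (fun r => b (Y r)) volume s t :=
  h.intervalIntegrable.mono_set (by
    rw [Set.uIcc_of_le hst, Set.uIcc_of_le (hs.trans (hst.trans ht))]
    exact Set.Icc_subset_Icc hs ht)

lemma sub_eq (h : IsPathSolution b x w T Y) {s t : ℝ} (hs : 0 ≤ s) (hst : s ≤ t) (ht : t ≤ T) :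
    Y t - Y s = w t - w s + ∫ r in s..t, b (Y r) := by
  rw [h.eq t ⟨hs.trans hst, ht⟩, h.eq s ⟨hs, hst.trans ht⟩,
    ← intervalIntegral.integral_add_adjacent_intervals
      (h.intervalIntegrable_of_le le_rfl hs (hst.trans ht))
      (h.intervalIntegrable_of_le hs hst ht)]
  ring

lemma apply_zero (h : IsPathSolution b x w T Y) (hT : 0 ≤ T) : Y 0 = x + w 0 := by
  simpa using h.eq 0 ⟨le_rfl, hT⟩

lemma mono_time (h : IsPathSolution b x w T Y) (hT : 0 ≤ T') (hT' : T' ≤ T) :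
    IsPathSolution b x w T' Y where
  continuousOn := h.continuousOn.mono (Set.Icc_subset_Icc_right hT')
  intervalIntegrable := h.intervalIntegrable_of_le le_rfl hT hT'
  eq t ht := h.eq t ⟨ht.1, ht.2.trans hT'⟩

lemma congr (h : IsPathSolution b x w T Y) (hT : 0 ≤ T)
    (hb : ∀ t ∈ Set.Icc 0 T, b' (Y' t) = b (Y t)) (hY : ∀ t ∈ Set.Icc 0 T, Y' t = Y t) :
    IsPathSolution b' x w T Y' where
  continuousOn := h.continuousOn.congr hY
  intervalIntegrable := h.intervalIntegrable.congr (fun t ht => by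
    rw [Set.uIoc_of_le hT] at ht
    exact (hb t ⟨ht.1.le, ht.2⟩).symm)
  eq t ht := by
    rw [hY t ht, h.eq t ht]
    congr 1
    apply intervalIntegral.integral_congr
    intro s hs
    rw [Set.uIcc_of_le ht.1] at hs
    exact (hb s ⟨hs.1, hs.2.trans ht.2⟩).symm

/-- Comparison of two solutions of equations driven by the same path. -/
lemma le_of_drift_le (h : IsPathSolution b x w T Y) (h' : IsPathSolution b' x' w T Y')
    (hx : x ≤ x')
    (hb : ∀ᵐ s, s ∈ Set.Icc 0 T → Y' s < Y s → b (Y s) ≤ b' (Y' s)) :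
    ∀ t ∈ Set.Icc 0 T, Y t ≤ Y' t := by
  intro t ht
  have hT : 0 ≤ T := ht.1.trans ht.2
  have key := nonpos_of_le_of_pos_Ioc (D := fun t => Y t - Y' t)
    (h.continuousOn.sub h'.continuousOn)
    (by simp only [h.apply_zero hT, h'.apply_zero hT]; linarith) ?_ t ht
  · exact sub_nonpos.1 key
  · intro s t hs hst htT hpos
    have h1 := h.sub_eq hs hst htT
    have h2 := h'.sub_eq hs hst htT
    have h3 : ∫ r in s..t, b (Y r) ≤ ∫ r in s..t, b' (Y' r) := by
      apply intervalIntegral.integral_mono_ae_restrict hst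
        (h.intervalIntegrable_of_le hs hst htT) (h'.intervalIntegrable_of_le hs hst htT)
      rw [← MeasureTheory.Measure.restrict_congr_set Ioc_ae_eq_Icc]
      filter_upwards [ae_restrict_of_ae hb, ae_restrict_mem measurableSet_Ioc] with r hr hmem
      exact hr ⟨hs.trans hmem.1.le, hmem.2.trans htT⟩ (by have := hpos r hmem; linarith)
    linarith

/-- A solution, looked at from time `r` on, solves the equation for the shifted path. -/
lemma shift (h : IsPathSolution b x w T Y) {r : ℝ} (hr : 0 ≤ r) (hrT : r ≤ T) :
    IsPathSolution b (Y r) (fun s => w (r + s) - w r) (T - r) (fun s => Y (r + s)) where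
  continuousOn := h.continuousOn.comp (by fun_prop) fun s hs =>
    ⟨by have := hs.1; linarith, by have := hs.2; linarith⟩
  intervalIntegrable := by
    have := (h.intervalIntegrable_of_le hr hrT le_rfl).comp_add_left r
    simpa using this
  eq t ht := by
    have := h.sub_eq hr (t := r + t) (by linarith [ht.1]) (by linarith [ht.2])
    have h2 := intervalIntegral.integral_comp_add_left (fun s => b (Y s)) r (a := 0) (b := t)
    rw [add_zero] at h2
    rw [h2]
    linarith

end IsPathSolution

/-! ### Truncated drifts -/

/-- Global existence for bounded Lipschitz drifts. -/
lemma exists_isPathSolution_of_lipschitz {b : ℝ → ℝ} {K : ℝ≥0} (hK : LipschitzWith K b) {M : ℝ≥0}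
    (hM : ∀ z, |b z| ≤ M) (x : ℝ) {w : ℝ → ℝ} (hw : Continuous w) {T : ℝ} (hT : 0 ≤ T) :
    ∃ Y, IsPathSolution b x w T Y := by
  -- The unknown is `y = Y - w`, which solves an ordinary differential equation. As the drift is
  -- bounded by `M`, a ball of radius `M * T` is never left and the whole interval is covered at
  -- once.
  have hpl : IsPicardLindelof (fun t y => b (y + w t)) (tmin := 0) (tmax := T) ⟨0, le_rfl, hT⟩ x
      (M * T.toNNReal) 0 M K :=
    { lipschitzOnWith := fun t _ => by
        have : LipschitzWith (K * 1) (b ∘ fun y => y + w t) :=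
          hK.comp (LipschitzWith.of_dist_le_mul fun y z => by simp)
        rw [mul_one] at this
        exact this.lipschitzOnWith
      continuousOn := fun y _ => (hK.continuous.comp (by fun_prop)).continuousOn
      norm_le := fun t _ y _ => hM _
      mul_max_le := by simp [hT] }
  obtain ⟨y, hy0, hy⟩ := hpl.exists_eq_forall_mem_Icc_hasDerivWithinAt₀
  have hyc : ContinuousOn y (Set.Icc 0 T) := fun t ht => (hy t ht).continuousWithinAt
  have hYc : ContinuousOn (fun t => y t + w t) (Set.Icc 0 T) := hyc.add hw.continuousOn
  have hbc : ContinuousOn (fun t => b (y t + w t)) (Set.Icc 0 T) :=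
    hK.continuous.comp_continuousOn hYc
  refine ⟨fun t => y t + w t, hYc, ?_, fun t ht => ?_⟩
  · exact hbc.intervalIntegrable_of_Icc hT
  · have := intervalIntegral.integral_eq_sub_of_hasDerivAt_of_le ht.1
      (hyc.mono (Set.Icc_subset_Icc_right ht.2))
      (fun s hs => (hy s ⟨hs.1.le, hs.2.le.trans ht.2⟩).hasDerivAt
        (Icc_mem_nhds hs.1 (hs.2.trans_le ht.2)))
      ((hbc.mono (Set.Icc_subset_Icc_right ht.2)).intervalIntegrable_of_Icc ht.1)
    simp only at hy0
    rw [this, hy0]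
    ring

/-- The drift of the half-line equation, made Lipschitz by freezing it below `ε`. -/
def truncatedDrift (a ε z : ℝ) : ℝ := halfLineDrift a (max z ε)

lemma truncatedDrift_of_le {a ε z : ℝ} (h : ε ≤ z) : truncatedDrift a ε z = halfLineDrift a z := by
  rw [truncatedDrift, max_eq_left h]

lemma truncatedDrift_nonneg {a ε : ℝ} (ha : 0 < a) (hε : 0 < ε) (z : ℝ) : 0 ≤ truncatedDrift a ε z :=
  (halfLineDrift_pos ha (lt_max_of_lt_right hε)).le

lemma truncatedDrift_le {a ε : ℝ} (ha : 0 < a) (hε : 0 < ε) (z : ℝ) : truncatedDrift a ε z ≤ ε⁻¹ :=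
  (halfLineDrift_le_inv ha (lt_max_of_lt_right hε)).trans (inv_anti₀ hε (le_max_right _ _))

lemma truncatedDrift_anti {a ε : ℝ} (ha : 0 < a) (hε : 0 < ε) : Antitone (truncatedDrift a ε) := fun _ _ h =>
  halfLineDrift_anti ha (lt_max_of_lt_right hε) (max_le_max_right _ h)

lemma abs_truncatedDrift_sub_le {a ε : ℝ} (ha : 0 < a) (hε : 0 < ε) (y z : ℝ) :
    |truncatedDrift a ε y - truncatedDrift a ε z| ≤ (1 / a + 1 / ε ^ 2) * |y - z| := by
  refine (abs_halfLineDrift_sub_le ha hε (le_max_right _ _) (le_max_right _ _)).trans ?_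
  exact mul_le_mul_of_nonneg_left (abs_max_sub_max_le_abs y z ε) (by positivity)

lemma exists_isPathSolution_truncatedDrift {a ε : ℝ} (ha : 0 < a) (hε : 0 < ε) (x : ℝ)
    {w : ℝ → ℝ} (hw : Continuous w) {T : ℝ}
    (hT : 0 ≤ T) : ∃ Y, IsPathSolution (truncatedDrift a ε) x w T Y := by
  have hK : 0 ≤ 1 / a + 1 / ε ^ 2 := by positivity
  refine exists_isPathSolution_of_lipschitz (K := ⟨_, hK⟩) (M := ⟨ε⁻¹, by positivity⟩)
    (LipschitzWith.of_dist_le_mul fun y z => ?_) (fun z => ?_) x hw hT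
  · exact abs_truncatedDrift_sub_le ha hε y z
  · rw [abs_of_nonneg (truncatedDrift_nonneg ha hε z)]
    exact truncatedDrift_le ha hε z

/-! ### Positive and global solutions -/

/-- A strictly positive solution of the half-line equation on `[0, T]`. -/
def IsPosSolution (a x : ℝ) (w : ℝ → ℝ) (T : ℝ) (Y : ℝ → ℝ) : Prop :=
  IsPathSolution (halfLineDrift a) x w T Y ∧ ∀ t ∈ Set.Icc 0 T, 0 < Y t

/-- If `0 < Y' < Y`, monotonicity in both variables puts the drift of `Y` below that of `Y'`. Only
the upper solution has to be positive, and only at almost every time, so solutions that touch `0`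
are covered. -/
lemma halfLine_comparison {a a' x x' T : ℝ} {w Y Y' : ℝ → ℝ} (ha : 0 < a) (haa' : a ≤ a')
    (hx : x ≤ x') (h : IsPathSolution (halfLineDrift a) x w T Y)
    (h' : IsPathSolution (halfLineDrift a') x' w T Y')
    (hpos' : ∀ᵐ s, s ∈ Set.Icc 0 T → 0 < Y' s) :
    ∀ t ∈ Set.Icc 0 T, Y t ≤ Y' t := by
  apply h.le_of_drift_le h' hx
  filter_upwards [hpos'] with s hs hmem hlt
  have h0 := hs hmem
  exact (halfLineDrift_anti ha h0 hlt.le).trans (halfLineDrift_mono_param ha haa' h0)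

lemma IsPathSolution.isPosSolution_of_truncatedDrift {a ε x T : ℝ} {w Y : ℝ → ℝ} (hε : 0 < ε)
    (hT : 0 ≤ T) (h : IsPathSolution (truncatedDrift a ε) x w T Y)
    (hle : ∀ t ∈ Set.Icc 0 T, ε ≤ Y t) : IsPosSolution a x w T Y :=
  ⟨h.congr hT (fun t ht => (truncatedDrift_of_le (hle t ht)).symm) fun _ _ => rfl,
    fun t ht => hε.trans_le (hle t ht)⟩

lemma IsPosSolution.exists_le {a x T : ℝ} {w Y : ℝ → ℝ} (h : IsPosSolution a x w T Y)
    (hT : 0 ≤ T) : ∃ ε > 0, ∀ t ∈ Set.Icc 0 T, ε ≤ Y t := by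
  obtain ⟨t, ht, hmin⟩ := isCompact_Icc.exists_isMinOn (Set.nonempty_Icc.2 hT) h.1.continuousOn
  exact ⟨Y t, h.2 t ht, fun s hs => hmin hs⟩

lemma IsPosSolution.truncatedDrift {a x T ε : ℝ} {w Y : ℝ → ℝ} (h : IsPosSolution a x w T Y)
    (hT : 0 ≤ T) (hle : ∀ t ∈ Set.Icc 0 T, ε ≤ Y t) :
    IsPathSolution (truncatedDrift a ε) x w T Y :=
  h.1.congr hT (fun t ht => truncatedDrift_of_le (hle t ht)) fun _ _ => rfl

/-- Positive solutions for small data produce positive solutions for larger data. -/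
lemma IsPosSolution.exists_of_le {a a' x x' T : ℝ} {w Y : ℝ → ℝ} (h : IsPosSolution a x w T Y)
    (ha : 0 < a) (haa' : a ≤ a') (hx : x ≤ x') (hT : 0 ≤ T) (hw : Continuous w) :
    ∃ Y', IsPosSolution a' x' w T Y' := by
  obtain ⟨ε, hε, hle⟩ := h.exists_le hT
  obtain ⟨Y', hY'⟩ := exists_isPathSolution_truncatedDrift (ha.trans_le haa') hε x' hw hT
  refine ⟨Y', hY'.isPosSolution_of_truncatedDrift hε hT fun t ht => ?_⟩
  -- The truncation level is a lower bound of the smaller solution, so comparison keeps `Y'` where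
  -- the truncation is inactive.
  refine (hle t ht).trans (h.1.le_of_drift_le hY' hx (ae_of_all _ fun s hs hlt => ?_) t ht)
  have h0 : 0 < max (Y' s) ε := lt_max_of_lt_right hε
  exact (halfLineDrift_anti ha h0 (max_le hlt.le (hle s hs))).trans
    (halfLineDrift_mono_param ha haa' h0)

/-- A nonnegative solution of the half-line equation on `[0, ∞)` which is positive at almost every
time. -/
structure IsGlobalSolution (a x : ℝ) (w Y : ℝ → ℝ) : Prop where
  isPathSolution : ∀ T, 0 ≤ T → IsPathSolution (halfLineDrift a) x w T Y
  nonneg : ∀ t, 0 ≤ t → 0 ≤ Y t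
  ae_pos : ∀ᵐ s : ℝ, 0 ≤ s → 0 < Y s

namespace IsGlobalSolution

variable {a a' x x' : ℝ} {w Y Y' : ℝ → ℝ}

lemma le (h : IsGlobalSolution a x w Y) (h' : IsGlobalSolution a' x' w Y') (ha : 0 < a)
    (haa' : a ≤ a') (hx : x ≤ x') {t : ℝ} (ht : 0 ≤ t) : Y t ≤ Y' t :=
  halfLine_comparison ha haa' hx (h.isPathSolution t ht) (h'.isPathSolution t ht)
    (h'.ae_pos.mono fun _ hs hmem => hs hmem.1) t ⟨ht, le_rfl⟩

lemma integral_nonneg (h : IsGlobalSolution a x w Y) (ha : 0 < a) {s t : ℝ} (hs : 0 ≤ s)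
    (hst : s ≤ t) : 0 ≤ ∫ r in s..t, halfLineDrift a (Y r) := by
  apply intervalIntegral.integral_nonneg_of_ae_restrict hst
  filter_upwards [ae_restrict_of_ae h.ae_pos, ae_restrict_mem measurableSet_Icc] with r hr hmem
  exact (halfLineDrift_pos ha (hr (hs.trans hmem.1))).le

end IsGlobalSolution

lemma IsPosSolution.mono_time {a x T T' : ℝ} {w Y : ℝ → ℝ} (h : IsPosSolution a x w T Y)
    (hT : 0 ≤ T') (hT' : T' ≤ T) : IsPosSolution a x w T' Y :=
  ⟨h.1.mono_time hT hT', fun t ht => h.2 t ⟨ht.1, ht.2.trans hT'⟩⟩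

lemma IsPosSolution.unique {a x T : ℝ} {w Y Y' : ℝ → ℝ} (ha : 0 < a) (h : IsPosSolution a x w T Y)
    (h' : IsPosSolution a x w T Y') : ∀ t ∈ Set.Icc 0 T, Y t = Y' t := fun t ht =>
  le_antisymm (halfLine_comparison ha le_rfl le_rfl h.1 h'.1 (ae_of_all _ h'.2) t ht)
    (halfLine_comparison ha le_rfl le_rfl h'.1 h.1 (ae_of_all _ h.2) t ht)

/-- Positive solutions on bounded intervals can be glued. -/
lemma exists_forall_isPosSolution {a x : ℝ} {w : ℝ → ℝ} (ha : 0 < a)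
    (h : ∀ T, 0 ≤ T → ∃ Y, IsPosSolution a x w T Y) :
    ∃ Y, ∀ T, 0 ≤ T → IsPosSolution a x w T Y := by
  choose! Y hY using h
  -- The value at time `t` is taken from the solution chosen on `[0, t]`; uniqueness makes these
  -- choices agree.
  refine ⟨fun t => Y t t, fun T hT => ?_⟩
  have heq : ∀ t ∈ Set.Icc 0 T, Y t t = Y T t := fun t ht =>
    (hY t ht.1).unique ha ((hY T hT).mono_time ht.1 ht.2) t ⟨ht.1, le_rfl⟩
  exact ⟨(hY T hT).1.congr hT (fun t ht => by rw [heq t ht]) heq,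
    fun t ht => by simpa only [heq t ht] using (hY T hT).2 t ht⟩

lemma isGlobalSolution_of_forall_isPosSolution {a x : ℝ} {w Y : ℝ → ℝ}
    (h : ∀ T, 0 ≤ T → IsPosSolution a x w T Y) : IsGlobalSolution a x w Y where
  isPathSolution T hT := (h T hT).1
  nonneg t ht := ((h t ht).2 t ⟨ht, le_rfl⟩).le
  ae_pos := ae_of_all _ fun t ht => (h t ht).2 t ⟨ht, le_rfl⟩

/-- Giving the drift the value `⊤` at `0` makes it continuous up to the boundary, so limits can be
taken before the limit path is known to be positive. -/
lemma tendsto_ofReal_halfLineDrift {a : ℝ} (ha : 0 < a) {u : ℕ → ℝ} (hu : ∀ n, 0 < u n) {z : ℝ}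
    (hz : 0 ≤ z) (h : Tendsto u atTop (𝓝 z)) :
    Tendsto (fun n => ENNReal.ofReal (halfLineDrift a (u n))) atTop
      (𝓝 (if z = 0 then ⊤ else ENNReal.ofReal (halfLineDrift a z))) := by
  split_ifs with h0
  · subst h0
    have h1 : Tendsto u atTop (𝓝[>] 0) :=
      tendsto_nhdsWithin_iff.2 ⟨h, Eventually.of_forall hu⟩
    have h2 : Tendsto (fun n => (u n)⁻¹ + -(u n / (2 * a))) atTop atTop :=
      (tendsto_inv_nhdsGT_zero.comp h1).atTop_add ((h.div_const (2 * a)).neg)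
    exact ENNReal.tendsto_ofReal_atTop.comp
      (tendsto_atTop_mono (fun n => by rw [← sub_eq_add_neg]; exact le_halfLineDrift ha (hu n)) h2)
  · have hz' : 0 < z := lt_of_le_of_ne hz (Ne.symm h0)
    exact (ENNReal.continuous_ofReal.tendsto _).comp
      ((hasDerivAt_halfLineDrift ha hz').continuousAt.tendsto.comp h)

/-- The limit of positive solutions as the initial value decreases is a solution. -/
lemma isGlobalSolution_of_tendsto {a x : ℝ} (ha : 0 < a) {w : ℝ → ℝ} (hw : Continuous w)
    {u : ℕ → ℝ} (hu : Antitone u) (hux : Tendsto u atTop (𝓝 x)) {X : ℕ → ℝ → ℝ}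
    (hX : ∀ n, ∀ T, 0 ≤ T → IsPosSolution a (u n) w T (X n)) {Z : ℝ → ℝ}
    (hZ : ∀ t, 0 ≤ t → Tendsto (fun n => X n t) atTop (𝓝 (Z t))) : IsGlobalSolution a x w Z := by
  have hpos : ∀ n t, 0 ≤ t → 0 < X n t := fun n t ht => (hX n t ht).2 t ⟨ht, le_rfl⟩
  have hanti : ∀ t, 0 ≤ t → Antitone fun n => X n t := fun t ht m n hmn =>
    (isGlobalSolution_of_forall_isPosSolution (hX n)).le
      (isGlobalSolution_of_forall_isPosSolution (hX m)) ha le_rfl (hu hmn) ht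
  have hZ0 : ∀ t, 0 ≤ t → 0 ≤ Z t := fun t ht =>
    ge_of_tendsto' (hZ t ht) fun n => (hpos n t ht).le
  have key : ∀ T, 0 ≤ T → (∀ᵐ s ∂volume.restrict (Set.Ioc 0 T), 0 < Z s) ∧
      IntervalIntegrable (fun s => halfLineDrift a (Z s)) volume 0 T ∧
      ∫ s in (0 : ℝ)..T, halfLineDrift a (Z s) = Z T - x - w T := by
    intro T hT
    set μ := volume.restrict (Set.Ioc (0 : ℝ) T) with hμ
    have hmem : ∀ᵐ s ∂μ, 0 ≤ s := by
      filter_upwards [ae_restrict_mem measurableSet_Ioc] with s hs using hs.1.le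
    have hXm : ∀ n, AEMeasurable (X n) μ := fun n =>
      ((hX n T hT).1.continuousOn.mono Set.Ioc_subset_Icc_self).aemeasurable measurableSet_Ioc
    have hZm : AEMeasurable Z μ := aemeasurable_of_tendsto_metrizable_ae atTop hXm
      (hmem.mono fun s hs => hZ s hs)
    have hfm : ∀ n, AEMeasurable (fun s => ENNReal.ofReal (halfLineDrift a (X n s))) μ := fun n =>
      ((measurable_halfLineDrift a).comp_aemeasurable (hXm n)).ennreal_ofReal
    set F : ℝ → ℝ≥0∞ := fun s => if Z s = 0 then ⊤ else ENNReal.ofReal (halfLineDrift a (Z s))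
    have hlim : ∀ᵐ s ∂μ, Tendsto (fun n => ENNReal.ofReal (halfLineDrift a (X n s))) atTop
        (𝓝 (F s)) := hmem.mono fun s hs =>
      tendsto_ofReal_halfLineDrift ha (fun n => hpos n s hs) (hZ0 s hs) (hZ s hs)
    have hFm : AEMeasurable F μ := aemeasurable_of_tendsto_metrizable_ae atTop hfm hlim
    -- As the paths decrease the drifts increase, so monotone convergence applies. The limit
    -- integral is finite by the equation, which forces `F < ⊤`, hence `Z > 0`, almost everywhere.
    have h1 := lintegral_tendsto_of_tendsto_of_monotone hfm (hmem.mono fun s hs m n hmn =>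
      ENNReal.ofReal_le_ofReal (halfLineDrift_anti ha (hpos n s hs) (hanti s hs hmn))) hlim
    have h2 : ∀ n, ∫⁻ s, ENNReal.ofReal (halfLineDrift a (X n s)) ∂μ =
        ENNReal.ofReal (X n T - u n - w T) := by
      intro n
      rw [← ofReal_integral_eq_lintegral_ofReal
        ((intervalIntegrable_iff_integrableOn_Ioc_of_le hT).1 (hX n T hT).1.intervalIntegrable)
        (hmem.mono fun s hs => (halfLineDrift_pos ha (hpos n s hs)).le),
        ← intervalIntegral.integral_of_le hT, (hX n T hT).1.eq T ⟨hT, le_rfl⟩]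
      congr 1
      ring
    simp_rw [h2] at h1
    have hlim3 : Tendsto (fun n => X n T - u n - w T) atTop (𝓝 (Z T - x - w T)) :=
      ((hZ T hT).sub hux).sub_const _
    have h3 : ∫⁻ s, F s ∂μ = ENNReal.ofReal (Z T - x - w T) :=
      tendsto_nhds_unique h1 ((ENNReal.continuous_ofReal.tendsto _).comp hlim3)
    have h4 : 0 ≤ Z T - x - w T := ge_of_tendsto' hlim3 fun n => by
      have := (hX n T hT).1.eq T ⟨hT, le_rfl⟩
      have h5 := (isGlobalSolution_of_forall_isPosSolution (hX n)).integral_nonneg ha le_rfl hT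
      linarith
    have h6 : ∀ᵐ s ∂μ, 0 < Z s := by
      filter_upwards [ae_lt_top' hFm (by rw [h3]; exact ENNReal.ofReal_ne_top), hmem] with s hs hs0
      refine lt_of_le_of_ne (hZ0 s hs0) fun h => ?_
      simp [F, ← h] at hs
    have h7 : ∫⁻ s, ENNReal.ofReal (halfLineDrift a (Z s)) ∂μ =
        ENNReal.ofReal (Z T - x - w T) := by
      rw [← h3]
      apply lintegral_congr_ae
      filter_upwards [h6] with s hs
      simp [F, hs.ne']
    have h8 : ∀ᵐ s ∂μ, 0 ≤ halfLineDrift a (Z s) :=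
      h6.mono fun s hs => (halfLineDrift_pos ha hs).le
    have h9 : AEStronglyMeasurable (fun s => halfLineDrift a (Z s)) μ :=
      ((measurable_halfLineDrift a).comp_aemeasurable hZm).aestronglyMeasurable
    refine ⟨h6, ?_, ?_⟩
    · rw [intervalIntegrable_iff_integrableOn_Ioc_of_le hT]
      refine ⟨h9, ?_⟩
      rw [hasFiniteIntegral_iff_ofReal h8, h7]
      exact ENNReal.ofReal_lt_top
    · rw [intervalIntegral.integral_of_le hT, integral_eq_lintegral_of_nonneg_ae h8 h9, h7,
        ENNReal.toReal_ofReal h4]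
  refine ⟨fun T hT => ⟨?_, (key T hT).2.1, fun t ht => ?_⟩, hZ0, ?_⟩
  · have h1 := intervalIntegral.continuousOn_primitive_interval
      ((intervalIntegrable_iff' (by simp)).1 (key T hT).2.1)
    rw [Set.uIcc_of_le hT] at h1
    refine ((continuousOn_const (c := x)).add (hw.continuousOn.add h1)).congr fun t ht => ?_
    have := (key t ht.1).2.2
    change Z t = x + (w t + ∫ s in (0 : ℝ)..t, halfLineDrift a (Z s))
    linarith
  · have := (key t ht.1).2.2
    linarith
  · have h1 : ∀ n : ℕ, ∀ᵐ s : ℝ, s ∈ Set.Ioc (0 : ℝ) n → 0 < Z s := fun n =>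
      (ae_restrict_iff' measurableSet_Ioc).1 (key n n.cast_nonneg).1
    have h2 : ∀ᵐ s : ℝ, s ≠ 0 := by simp [ae_iff]
    filter_upwards [ae_all_iff.2 h1, h2] with s hs hs0 hs1
    obtain ⟨n, hn⟩ := exists_nat_ge s
    exact hs n ⟨lt_of_le_of_ne hs1 (Ne.symm hs0), hn⟩

/-! ### Flow properties on non-hitting paths -/

/-- A continuous path from `0` for which, after each rational time, the half-line equations with
positive initial values have positive solutions. -/
structure IsNonHittingPath (w : ℝ → ℝ) : Prop where
  continuous : Continuous w
  apply_zero : w 0 = 0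
  exists_isPosSolution : ∀ (q : ℚ≥0) (a x T : ℝ), 0 < a → 0 < x → 0 ≤ T →
    ∃ Y, IsPosSolution a x (fun s => w (q + s) - w q) T Y

namespace IsNonHittingPath

variable {w : ℝ → ℝ} {a x : ℝ}

lemma exists_forall_isPosSolution (hw : IsNonHittingPath w) (ha : 0 < a) (hx : 0 < x) :
    ∃ Y, ∀ T, 0 ≤ T → IsPosSolution a x w T Y :=
  _root_.exists_forall_isPosSolution ha fun T hT => by
    simpa [hw.apply_zero] using hw.exists_isPosSolution 0 a x T ha hx hT

/-- The solution started at `x ≥ 0` exists and is the limit of those started at larger points. -/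
lemma exists_isGlobalSolution (hw : IsNonHittingPath w) (ha : 0 < a) (hx : 0 ≤ x) :
    ∃ Z, IsGlobalSolution a x w Z ∧ ∀ X : ℕ → ℝ → ℝ,
      (∀ n : ℕ, ∀ T, 0 ≤ T → IsPosSolution a (x + 1 / ((n : ℝ) + 1)) w T (X n)) →
      ∀ t, 0 ≤ t → Tendsto (fun n => X n t) atTop (𝓝 (Z t)) := by
  have hun : ∀ n : ℕ, 0 < x + 1 / ((n : ℝ) + 1) := fun n => by positivity
  choose X hX using fun n : ℕ => hw.exists_forall_isPosSolution ha (hun n)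
  have hu : Antitone fun n : ℕ => x + 1 / ((n : ℝ) + 1) := fun m n hmn => by
    simp only
    gcongr
  have hux : Tendsto (fun n : ℕ => x + 1 / ((n : ℝ) + 1)) atTop (𝓝 x) := by
    simpa using tendsto_one_div_add_atTop_nhds_zero_nat.const_add x
  have hanti : ∀ t, 0 ≤ t → Antitone fun n => X n t := fun t ht m n hmn =>
    (isGlobalSolution_of_forall_isPosSolution (hX n)).le
      (isGlobalSolution_of_forall_isPosSolution (hX m)) ha le_rfl (hu hmn) ht
  have hZ : ∀ t, 0 ≤ t → Tendsto (fun n => X n t) atTop (𝓝 (⨅ n, X n t)) := fun t ht =>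
    tendsto_atTop_ciInf (hanti t ht) ⟨0, by
      rintro _ ⟨n, rfl⟩
      exact ((hX n t ht).2 t ⟨ht, le_rfl⟩).le⟩
  refine ⟨fun t => ⨅ n, X n t, isGlobalSolution_of_tendsto ha hw.continuous hu hux hX hZ,
    fun X' hX' t ht => ?_⟩
  refine (hZ t ht).congr fun n => ?_
  exact (hX n t ht).unique ha (hX' n t ht) t ⟨ht, le_rfl⟩

/-- For `x > 0`, compare with the positive solution from `x`. For `x = 0`, almost-everywhere
positivity and continuity give a rational time before `t` at which `Z > 0`; the solution restarted
there dominates a positive one. -/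
lemma pos (hw : IsNonHittingPath w) (ha : 0 < a) {Z : ℝ → ℝ}
    (hZ : IsGlobalSolution a x w Z) {t : ℝ} (ht : 0 ≤ t) (hxt : 0 < x ∨ 0 < t) : 0 < Z t := by
  rcases hxt with hx0 | ht0
  · obtain ⟨Y, hY⟩ := hw.exists_forall_isPosSolution ha hx0
    exact ((hY t ht).2 t ⟨ht, le_rfl⟩).trans_le
      ((isGlobalSolution_of_forall_isPosSolution hY).le hZ ha le_rfl le_rfl ht)
  · obtain ⟨s, hs, hsZ⟩ : ∃ s ∈ Set.Ioo 0 t, 0 < Z s := by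
      by_contra! hcon
      have h0 : volume (Set.Ioo 0 t) = 0 := by
        refine measure_mono_null (fun s hs => ?_) (ae_iff.1 hZ.ae_pos)
        simp only [Set.mem_ofPred_eq, not_forall, not_lt]
        exact ⟨hs.1.le, hcon s hs⟩
      simp at h0
      linarith
    have hcont : ContinuousAt Z s := ((hZ.isPathSolution t ht).continuousOn s
      ⟨hs.1.le, hs.2.le⟩).continuousAt (Icc_mem_nhds hs.1 hs.2)
    obtain ⟨l, u, hlu, hsub⟩ := mem_nhds_iff_exists_Ioo_subset.1
      (Filter.inter_mem (hcont (Ioi_mem_nhds hsZ)) (Ioo_mem_nhds hs.1 hs.2))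
    obtain ⟨q, hq1, hq2⟩ := exists_rat_btwn (hlu.1.trans hlu.2)
    obtain ⟨hqZ, hq0, hqt⟩ := hsub ⟨hq1, hq2⟩
    have hq0' : 0 ≤ q := by exact_mod_cast hq0.le
    obtain ⟨Y, hY⟩ := hw.exists_isPosSolution ⟨q, hq0'⟩ a (Z q) (t - q) ha hqZ (by linarith)
    have hsh := (hZ.isPathSolution t ht).shift hq0.le hqt.le
    have hle := halfLine_comparison ha le_rfl le_rfl hY.1 hsh ?_ (t - q) ⟨by linarith, le_rfl⟩
    · have := hY.2 (t - q) ⟨by linarith, le_rfl⟩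
      simp only [add_sub_cancel] at hle
      linarith
    · have := (measurePreserving_add_left volume (q : ℝ)).quasiMeasurePreserving.ae hZ.ae_pos
      filter_upwards [this] with r hr hmem
      exact hr (by have := hmem.1; linarith)

/-- Solutions started at different points never meet. -/
lemma lt (hw : IsNonHittingPath w) (ha : 0 < a) {x' : ℝ} (hxx' : x < x')
    {Y Y' : ℝ → ℝ} (hY : IsGlobalSolution a x w Y) (hY' : IsGlobalSolution a x' w Y') {t : ℝ}
    (ht : 0 ≤ t) : Y t < Y' t := by
  by_contra! hcon
  have hYc := (hY.isPathSolution t ht).continuousOn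
  have hYc' := (hY'.isPathSolution t ht).continuousOn
  have hDc : ContinuousOn (fun s => Y' s - Y s) (Set.Icc 0 t) := hYc'.sub hYc
  set S : Set ℝ := Set.Icc 0 t ∩ (fun s => Y' s - Y s) ⁻¹' Set.Iic 0 with hS
  have hclosed : IsClosed S := hDc.preimage_isClosed_of_isClosed isClosed_Icc isClosed_Iic
  have hbdd : BddBelow S := ⟨0, fun r hr => hr.1.1⟩
  have hmem : sInf S ∈ S := hclosed.csInf_mem ⟨t, ⟨ht, le_rfl⟩, by simpa using hcon⟩ hbdd
  set s₀ := sInf S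
  have hs0 : Y' s₀ - Y s₀ ≤ 0 := hmem.2
  have hs0pos : 0 < s₀ := by
    refine lt_of_le_of_ne hmem.1.1 fun h => ?_
    rw [← h, (hY.isPathSolution t ht).apply_zero ht, (hY'.isPathSolution t ht).apply_zero ht] at hs0
    linarith
  have hYpos : 0 < Y s₀ := hw.pos ha hY hmem.1.1 (Or.inr hs0pos)
  set η := Y s₀ / 2 with hη
  have hη0 : 0 < η := by positivity
  set K := 1 / a + 1 / η ^ 2 with hK
  have hK0 : 0 < K := by positivity
  have hnear : ∀ᶠ s in 𝓝[Set.Icc 0 t] s₀, η < Y s :=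
    (hYc s₀ hmem.1).eventually (lt_mem_nhds (by linarith))
  obtain ⟨δ, hδ, hball⟩ := Metric.mem_nhdsWithin_iff.1 hnear
  -- Before the first meeting time `s₀` the drift is `K`-Lipschitz along both paths. On an interval
  -- shorter than `1 / (2K)` the maximal gap is then at most half of itself, hence zero, so the
  -- paths have already met at `s₁`.
  obtain ⟨s₁, hs1, hs1'⟩ : ∃ s₁, max (max 0 (s₀ - δ)) (s₀ - 1 / (2 * K)) < s₁ ∧ s₁ < s₀ :=
    exists_between (max_lt (max_lt hs0pos (by linarith)) (by
      have : 0 < 1 / (2 * K) := by positivity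
      linarith))
  simp only [max_lt_iff] at hs1
  obtain ⟨⟨h10, h1δ⟩, h1K⟩ := hs1
  have hYη : ∀ r ∈ Set.Icc s₁ s₀, η ≤ Y r := fun r hr => by
    have : r ∈ Metric.ball s₀ δ ∩ Set.Icc 0 t := by
      refine ⟨?_, h10.le.trans hr.1, hr.2.trans hmem.1.2⟩
      rw [Metric.mem_ball, Real.dist_eq, abs_lt]
      constructor <;> linarith [hr.1, hr.2]
    exact (hball this).le
  have hle : ∀ r, 0 ≤ r → Y r ≤ Y' r := fun r hr => hY.le hY' ha le_rfl hxx'.le hr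
  obtain ⟨m, hm, hmax⟩ := isCompact_Icc.exists_isMaxOn (Set.nonempty_Icc.2 hs1'.le)
    (hDc.mono (Set.Icc_subset_Icc h10.le hmem.1.2))
  have hm0 : 0 ≤ m := h10.le.trans hm.1
  have hI := (hY.isPathSolution t ht).sub_eq hm0 hm.2 hmem.1.2
  have hI' := (hY'.isPathSolution t ht).sub_eq hm0 hm.2 hmem.1.2
  have hsub := intervalIntegral.integral_sub
    ((hY'.isPathSolution t ht).intervalIntegrable_of_le hm0 hm.2 hmem.1.2)
    ((hY.isPathSolution t ht).intervalIntegrable_of_le hm0 hm.2 hmem.1.2)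
  have hbound := intervalIntegral.norm_integral_le_of_norm_le_const (a := m) (b := s₀)
    (f := fun r => halfLineDrift a (Y' r) - halfLineDrift a (Y r)) (C := K * (Y' m - Y m)) ?_
  · rw [Real.norm_eq_abs, abs_of_nonneg (by linarith [hm.2] : 0 ≤ s₀ - m)] at hbound
    have h1 : Y' m - Y m ≤ K * (Y' m - Y m) * (s₀ - m) := by
      have := (abs_le.1 hbound).1
      linarith
    have h2 : s₀ - m ≤ 1 / (2 * K) := by linarith [hm.1]
    have h3 : 0 ≤ Y' m - Y m := by linarith [hle m hm0]
    have h4 : K * (Y' m - Y m) * (s₀ - m) ≤ (Y' m - Y m) / 2 := by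
      calc K * (Y' m - Y m) * (s₀ - m) ≤ K * (Y' m - Y m) * (1 / (2 * K)) := by gcongr
        _ = (Y' m - Y m) / 2 := by field_simp
    have h5 : Y' s₁ - Y s₁ ≤ Y' m - Y m := hmax ⟨le_rfl, hs1'.le⟩
    have h6 : s₁ ∈ S := ⟨⟨h10.le, hs1'.le.trans hmem.1.2⟩, by
      simp only [Set.mem_preimage, Set.mem_Iic]
      linarith⟩
    exact absurd (csInf_le hbdd h6) (not_le.2 hs1')
  · intro r hr
    rw [Set.uIoc_of_le hm.2] at hr
    have hr' : r ∈ Set.Icc s₁ s₀ := ⟨hm.1.trans hr.1.le, hr.2⟩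
    have hr0 := h10.le.trans hr'.1
    refine (abs_halfLineDrift_sub_le ha hη0 ((hYη r hr').trans (hle r hr0)) (hYη r hr')).trans ?_
    rw [abs_of_nonneg (by linarith [hle r hr0])]
    exact mul_le_mul_of_nonneg_left (hmax hr') hK0.le

end IsNonHittingPath

/-! ### The Skorohod problem -/

/-- The reflection problem on the half line is solvable for continuous paths. -/
lemma exists_isSkorohodSolution {x : ℝ} (hx : 0 ≤ x) {f : ℝ≥0 → ℝ} (hf : Continuous f)
    (hf0 : f 0 = 0) : ∃ g h, IsSkorohodSolution x f g h := by
  set φ : ℝ≥0 → ℝ := fun s => max 0 (-(x + f s)) with hφ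
  have hφc : Continuous φ := by fun_prop
  -- This is the running maximum of `φ` on `[0, t]`, rescaled to the fixed compact set `[0, 1]` so
  -- that continuity in `t` is immediate.
  set h : ℝ≥0 → ℝ := fun t => sSup ((fun u : ℝ≥0 => φ (t * u)) '' Set.Icc 0 1) with hh
  have hcont : Continuous h :=
    isCompact_Icc.continuous_sSup (f := fun t u : ℝ≥0 => φ (t * u)) (by fun_prop)
  have hle : ∀ s t, s ≤ t → φ s ≤ h t := by
    intro s t hst
    have hbdd : BddAbove ((fun u : ℝ≥0 => φ (t * u)) '' Set.Icc 0 1) :=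
      isCompact_Icc.bddAbove_image (by fun_prop)
    rcases eq_or_ne t 0 with rfl | ht
    · exact le_csSup hbdd ⟨0, by simp, by simp [nonpos_iff_eq_zero.1 hst]⟩
    · refine le_csSup hbdd ⟨s / t, ⟨zero_le, div_le_one_of_le₀ hst zero_le⟩, ?_⟩
      simp only
      rw [mul_div_cancel₀ _ ht]
  have hmax : ∀ t, ∃ s ≤ t, h t = φ s := by
    intro t
    obtain ⟨u, hu, hmem⟩ := isCompact_Icc.exists_sSup_image_eq (s := Set.Icc (0 : ℝ≥0) 1)
      ⟨0, by simp⟩ (f := fun u : ℝ≥0 => φ (t * u)) (by fun_prop)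
    exact ⟨t * u, mul_le_of_le_one_right zero_le hu.2, hmem⟩
  have hmono : Monotone h := fun s t hst => by
    obtain ⟨r, hr, hrs⟩ := hmax s
    rw [hrs]
    exact hle r t (hr.trans hst)
  have h0 : h 0 = 0 := by
    obtain ⟨r, hr, hrs⟩ := hmax 0
    rw [hrs, nonpos_iff_eq_zero.1 hr]
    simp [hφ, hf0, hx]
  let H : StieltjesFunction ℝ :=
    { toFun := fun s => h s.toNNReal
      mono' := fun _ _ hst => hmono (Real.toNNReal_mono hst)
      right_continuous' := fun s => (hcont.comp continuous_real_toNNReal).continuousWithinAt }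
  have hH : ∀ s, H s = h s.toNNReal := fun _ => rfl
  refine ⟨fun t => x + f t + h t, h, fun _ => rfl, fun t => ?_, hcont, hmono, h0, H, hH,
    fun t => ?_⟩
  · have := (le_max_right 0 (-(x + f t))).trans (hle t t le_rfl)
    linarith
  · set A : Set ℝ := {r : ℝ | x + f r.toNNReal + h r.toNNReal = 0} with hA
    have hAc : Continuous fun r : ℝ => x + f r.toNNReal + h r.toNNReal := by
      have := continuous_real_toNNReal
      fun_prop
    have hAm : MeasurableSet A := (isClosed_eq hAc continuous_const).measurableSet
    -- Where the reflected path is positive, a constant `c` separates `-(x + f)` from `h` on a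
    -- neighbourhood. The running maximum is not renewed there, so `h` is locally constant.
    have hnull : H.measure (Set.Ioc 0 (t : ℝ) \ A) = 0 := by
      refine measure_null_of_locally_null _ fun s hs => ?_
      have hpos : -(x + f s.toNNReal) < h s.toNNReal := by
        have h1 : -(x + f s.toNNReal) ≤ h s.toNNReal :=
          (le_max_right 0 (-(x + f s.toNNReal))).trans (hle _ _ le_rfl)
        refine lt_of_le_of_ne h1 fun h2 => hs.2 ?_
        simp only [hA, Set.mem_ofPred_eq]
        linarith
      obtain ⟨c, hc1, hc2⟩ := exists_between hpos
      have hfc : Continuous fun r : ℝ => -(x + f r.toNNReal) := by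
        have := continuous_real_toNNReal
        fun_prop
      have hhc : Continuous fun r : ℝ => h r.toNNReal := hcont.comp continuous_real_toNNReal
      have hnhds : {r : ℝ | -(x + f r.toNNReal) < c ∧ c < h r.toNNReal} ∈ 𝓝 s :=
        (hfc.continuousAt.eventually (gt_mem_nhds hc1)).and
          (hhc.continuousAt.eventually (lt_mem_nhds hc2))
      obtain ⟨δ, hδ, hball⟩ := Metric.mem_nhds_iff.1 hnhds
      refine ⟨Set.Ioc (s - δ / 2) (s + δ / 2), mem_nhdsWithin_of_mem_nhds
        (Ioc_mem_nhds (by linarith) (by linarith)), ?_⟩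
      have hmem : ∀ r ∈ Set.Icc (s - δ / 2) (s + δ / 2),
          -(x + f r.toNNReal) < c ∧ c < h r.toNNReal := fun r hr => by
        apply hball
        rw [Metric.mem_ball, Real.dist_eq, abs_lt]
        constructor <;> linarith [hr.1, hr.2]
      rw [StieltjesFunction.measure_Ioc, hH, hH, ENNReal.ofReal_eq_zero, sub_nonpos]
      obtain ⟨r, hr, hrs⟩ := hmax (s + δ / 2).toNNReal
      rw [hrs]
      rcases le_total (-(x + f r)) 0 with hr0 | hr0
      · exact (max_eq_left hr0).trans_le ((le_max_left _ _).trans (hle _ _ le_rfl))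
      by_cases hrl : r ≤ (s - δ / 2).toNNReal
      · exact hle _ _ hrl
      · exfalso
        rw [not_le] at hrl
        have hr1 : s - δ / 2 ≤ r := (Real.le_coe_toNNReal _).trans (NNReal.coe_le_coe.2 hrl.le)
        have hr2 : (r : ℝ) ≤ s + δ / 2 := by
          have h3 : 0 ≤ s + δ / 2 := by linarith [hs.1.1]
          have := NNReal.coe_le_coe.2 hr
          rwa [Real.coe_toNNReal _ h3] at this
        have h4 := (hmem r ⟨hr1, hr2⟩).1
        have h5 := (hmem (s + δ / 2) ⟨by linarith, le_rfl⟩).2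
        rw [Real.toNNReal_coe] at h4
        rw [hrs, show φ r = -(x + f r) from max_eq_right hr0] at h5
        linarith
    rw [integral_indicator hAm, Measure.restrict_restrict hAm, setIntegral_const, smul_eq_mul,
      mul_one, measureReal_def]
    have h1 : H.measure (A ∩ Set.Ioc 0 (t : ℝ)) = H.measure (Set.Ioc 0 (t : ℝ)) := by
      rw [Set.inter_comm, ← measure_inter_add_sdiff (Set.Ioc 0 (t : ℝ)) hAm, hnull, add_zero]
    rw [h1, StieltjesFunction.measure_Ioc, hH, hH, Real.toNNReal_coe, Real.toNNReal_zero, h0,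
      sub_zero, ENNReal.toReal_ofReal]
    rw [← h0]
    exact hmono zero_le

namespace IsSkorohodSolution

variable {x : ℝ} {f g h : ℝ≥0 → ℝ}

lemma continuous_fst (hs : IsSkorohodSolution x f g h) (hf : Continuous f) : Continuous g := by
  have : g = fun t => x + f t + h t := funext hs.eq
  rw [this]
  exact (continuous_const.add hf).add hs.continuous

/-- The reflection term is constant while the reflected path is positive. -/
lemma eq_of_pos (hs : IsSkorohodSolution x f g h) (hf : Continuous f) {s t : ℝ} (hs0 : 0 ≤ s)
    (hst : s ≤ t) (hpos : ∀ r ∈ Set.Ioc s t, 0 < g r.toNNReal) : h t.toNNReal = h s.toNNReal := by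
  obtain ⟨H, hH, hint⟩ := hs.integral_eq
  have ht0 : 0 ≤ t := hs0.trans hst
  set A : Set ℝ := {r : ℝ | g r.toNNReal = 0} with hA
  have hgc : Continuous g := hs.continuous_fst hf
  have hAm : MeasurableSet A :=
    (isClosed_eq (hgc.comp continuous_real_toNNReal) continuous_const).measurableSet
  have h1 := hint t.toNNReal
  rw [integral_indicator hAm, Measure.restrict_restrict hAm, setIntegral_const, smul_eq_mul,
    mul_one, Real.coe_toNNReal t ht0] at h1
  have hmono : ∀ {p q : ℝ}, p ≤ q → h p.toNNReal ≤ h q.toNNReal := fun hpq =>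
    hs.monotone (Real.toNNReal_mono hpq)
  have hsub : A ∩ Set.Ioc 0 t ⊆ Set.Ioc 0 s := fun r hr => by
    refine ⟨hr.2.1, ?_⟩
    by_contra! hsr
    exact (hpos r ⟨hsr, hr.2.2⟩).ne' hr.1
  -- The left side is `h t`, since the zero set carries all of the mass; the right side is `h s`.
  have h2 : H.measure.real (A ∩ Set.Ioc 0 t) ≤ H.measure.real (Set.Ioc 0 s) :=
    measureReal_mono hsub (by simp [StieltjesFunction.measure_Ioc])
  rw [h1, measureReal_def, StieltjesFunction.measure_Ioc, hH, hH, Real.toNNReal_zero, hs.zero,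
    sub_zero, ENNReal.toReal_ofReal] at h2
  · exact le_antisymm h2 (hmono hst)
  · rw [← hs.zero]
    exact hs.monotone zero_le

lemma apply_zero (hs : IsSkorohodSolution x f g h) : g 0 = x + f 0 := by
  rw [hs.eq, hs.zero, add_zero]

/-- While `g > Y ≥ 0` the reflection term is constant, whereas the integrated drift of `Y` is
nondecreasing; hence `g - Y` cannot increase. -/
lemma le_globalSolution (hs : IsSkorohodSolution x f g h) (hf : Continuous f) {a : ℝ} (ha : 0 < a)
    {Y : ℝ → ℝ} (hY : IsGlobalSolution a x (fun s => f s.toNNReal) Y) (t : ℝ≥0) : g t ≤ Y t := by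
  have key := nonpos_of_le_of_pos_Ioc (D := fun s => g s.toNNReal - Y s) (T := t)
    ((((hs.continuous_fst hf).comp continuous_real_toNNReal).continuousOn).sub
      (hY.isPathSolution t t.2).continuousOn) ?_ ?_ t ⟨t.2, le_rfl⟩
  · simpa using key
  · simp [(hY.isPathSolution t t.2).apply_zero t.2, hs.apply_zero]
  · intro p q hp hpq hq hpos
    have h1 := (hY.isPathSolution t t.2).sub_eq hp hpq hq
    have h2 := hY.integral_nonneg ha hp hpq
    have h3 := hs.eq_of_pos hf hp hpq fun r hr => by
      have := hpos r hr
      have := hY.nonneg r (hp.trans hr.1.le)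
      linarith
    simp only [hs.eq, h3]
    linarith

/-- While `Y` exceeds the right-hand side it lies above `δ`, so its drift is at most the slope
`halfLineDrift a δ`; the reflection term of `g` can only help. -/
lemma globalSolution_le (hs : IsSkorohodSolution x f g h) (hf : Continuous f) {a δ : ℝ}
    (ha : 0 < a) (hδ : 0 < δ) {Y : ℝ → ℝ}
    (hY : IsGlobalSolution a x (fun s => f s.toNNReal) Y) (t : ℝ≥0) :
    Y t ≤ g t + δ + halfLineDrift a δ * t := by
  have hc := halfLineDrift_pos ha hδ
  have key := nonpos_of_le_of_pos_Ioc
    (D := fun s => Y s - (g s.toNNReal + δ + halfLineDrift a δ * s)) (T := t)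
    ((hY.isPathSolution t t.2).continuousOn.sub
      (((((hs.continuous_fst hf).comp continuous_real_toNNReal)).add continuous_const).add
        (continuous_const.mul continuous_id)).continuousOn) ?_ ?_ t ⟨t.2, le_rfl⟩
  · simpa using key
  · simp [(hY.isPathSolution t t.2).apply_zero t.2, hs.apply_zero, hδ.le]
  · intro p q hp hpq hq hpos
    have h1 := (hY.isPathSolution t t.2).sub_eq hp hpq hq
    have h3 : h p.toNNReal ≤ h q.toNNReal := hs.monotone (Real.toNNReal_mono hpq)
    have h2 : ∫ r in p..q, halfLineDrift a (Y r) ≤ ∫ _ in p..q, halfLineDrift a δ := by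
      apply intervalIntegral.integral_mono_ae_restrict hpq
        ((hY.isPathSolution t t.2).intervalIntegrable_of_le hp hpq hq) (by simp)
      rw [← MeasureTheory.Measure.restrict_congr_set Ioc_ae_eq_Icc]
      filter_upwards [ae_restrict_mem measurableSet_Ioc] with r hr
      apply halfLineDrift_anti ha hδ
      have h4 := hpos r hr
      have h5 := hs.nonneg r.toNNReal
      have h6 : 0 ≤ halfLineDrift a δ * r := mul_nonneg hc.le (hp.trans hr.1.le)
      linarith
    rw [intervalIntegral.integral_const, smul_eq_mul] at h2
    simp only [hs.eq]
    linarith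

/-- The solutions of the half-line equations converge to the reflected path as `a ↓ 0`. -/
lemma tendsto_globalSolution (hs : IsSkorohodSolution x f g h) (hf : Continuous f)
    {Y : ℝ → ℝ → ℝ} (hY : ∀ a, 0 < a → IsGlobalSolution a x (fun s => f s.toNNReal) (Y a))
    (t : ℝ≥0) : Tendsto (fun a => Y a t) (𝓝[>] 0) (𝓝 (g t)) := by
  rw [tendsto_order]
  constructor
  · intro c hc
    filter_upwards [self_mem_nhdsWithin] with a ha
    exact hc.trans_le (hs.le_globalSolution hf ha (hY a ha) t)
  · intro c hc
    set δ := (c - g t) / 2 with hδ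
    have hδ0 : 0 < δ := by rw [hδ]; linarith
    have hlim : Tendsto (fun a : ℝ => 3 * a / δ ^ 3 * t) (𝓝[>] 0) (𝓝 0) := by
      have : Continuous fun a : ℝ => 3 * a / δ ^ 3 * t := by fun_prop
      have h0 := this.tendsto 0
      simp only [mul_zero, zero_div, zero_mul] at h0
      exact h0.mono_left nhdsWithin_le_nhds
    filter_upwards [self_mem_nhdsWithin, hlim.eventually (gt_mem_nhds hδ0)] with a ha hlt
    have h1 := hs.globalSolution_le hf ha hδ0 (hY a ha) t
    have h2 : halfLineDrift a δ * t ≤ 3 * a / δ ^ 3 * t :=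
      mul_le_mul_of_nonneg_right (halfLineDrift_le_mul ha hδ0) t.2
    linarith

/-- If the driving path is unbounded in both directions, the reflected path differs from the
absolute value. -/
lemma exists_ne_abs (hs : IsSkorohodSolution x f g h) (hf : Continuous f)
    (hbelow : ∀ c : ℝ, ∃ t, f t < c) (habove : ∀ c : ℝ, ∃ t, c < f t) :
    ∃ t, g t ≠ |x + f t| := by
  by_contra! hcon
  obtain ⟨s, hs0⟩ := hbelow (-x)
  -- Exceeding the maximum of `f` on `[0, s]` forces `t` to come after `s`. For `g = |x + f|` one
  -- would have `h s > 0` but `h t = 0`, against monotonicity.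
  obtain ⟨C, hC⟩ := isCompact_Icc.bddAbove_image (K := Set.Icc 0 s) hf.continuousOn
  obtain ⟨t, ht⟩ := habove (max C (-x))
  obtain ⟨ht1, ht2⟩ := max_lt_iff.1 ht
  have hst : s ≤ t := by
    by_contra! hts
    exact (hC ⟨t, ⟨zero_le, hts.le⟩, rfl⟩).not_gt ht1
  have h1 := hs.monotone hst
  have h2 := hs.eq s
  have h3 := hs.eq t
  rw [hcon, abs_of_neg (by linarith)] at h2
  rw [hcon, abs_of_pos (by linarith)] at h3
  linarith

end IsSkorohodSolution

/-! ### Frozen Euler schemes -/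

/-- The Euler scheme with drift `b`, step `h` and noise increments `ξ`, frozen as soon as it falls
below the level `c`. -/
def frozenEuler (b : ℝ → ℝ) (c h x : ℝ) (ξ : ℕ → ℝ) : ℕ → ℝ
  | 0 => x
  | k + 1 => if frozenEuler b c h x ξ k < c then frozenEuler b c h x ξ k
      else frozenEuler b c h x ξ k + h * b (frozenEuler b c h x ξ k) + ξ k

section frozenEuler

variable {b b' : ℝ → ℝ} {c h x : ℝ} {ξ ξ' : ℕ → ℝ}

lemma frozenEuler_succ_of_le {k : ℕ} (hk : c ≤ frozenEuler b c h x ξ k) :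
    frozenEuler b c h x ξ (k + 1) =
      frozenEuler b c h x ξ k + h * b (frozenEuler b c h x ξ k) + ξ k :=
  if_neg (not_lt.2 hk)

lemma frozenEuler_succ_of_lt {k : ℕ} (hk : frozenEuler b c h x ξ k < c) :
    frozenEuler b c h x ξ (k + 1) = frozenEuler b c h x ξ k :=
  if_pos hk

lemma frozenEuler_congr {k : ℕ} (hξ : ∀ j < k, ξ j = ξ' j) :
    frozenEuler b c h x ξ k = frozenEuler b c h x ξ' k := by
  induction k with
  | zero => rfl
  | succ k ih => simp only [frozenEuler, ih fun j hj => hξ j (hj.trans k.lt_succ_self),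
      hξ k k.lt_succ_self]

/-- Freezing is permanent, so the terminal value alone tells whether the scheme ever fell below `c`.
-/
lemma le_frozenEuler_of_le {k n : ℕ} (hkn : k ≤ n) (hn : c ≤ frozenEuler b c h x ξ n) :
    c ≤ frozenEuler b c h x ξ k := by
  by_contra! hlt
  have : ∀ m, k ≤ m → frozenEuler b c h x ξ m < c := fun m hm => by
    induction m, hm using Nat.le_induction with
    | base => exact hlt
    | succ m _ ih => rwa [frozenEuler_succ_of_lt ih]
  exact (this n hkn).not_ge hn

lemma measurable_frozenEuler {α : Type*} [MeasurableSpace α] (hb : Measurable b)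
    {ξ : α → ℕ → ℝ} (hξ : ∀ j, Measurable fun p => ξ p j) (k : ℕ) :
    Measurable fun p => frozenEuler b c h x (ξ p) k := by
  induction k with
  | zero => exact measurable_const
  | succ k ih =>
    exact Measurable.ite (measurableSet_lt ih measurable_const) ih
      ((ih.add ((hb.comp ih).const_mul h)).add (hξ k))

/-- The error of the Euler scheme: for a decreasing drift the local errors only add up. -/
lemma abs_frozenEuler_sub_le {T K η : ℝ} {w Y : ℝ → ℝ} (hY : IsPathSolution b' x w T Y)
    (hw : w 0 = 0) (hT : 0 ≤ T) (hanti : Antitone b') (hK : 0 ≤ K)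
    (hlip : ∀ y z, |b' y - b' z| ≤ K * |y - z|) (hbb' : ∀ z, c ≤ z → b' z = b z) (hh : 0 ≤ h)
    (hhK : h * K ≤ 1)
    (hosc : ∀ s ∈ Set.Icc 0 T, ∀ t ∈ Set.Icc 0 T, |s - t| ≤ h → |Y s - Y t| ≤ η)
    (hξ : ∀ k : ℕ, ξ k = w ((k + 1) * h) - w (k * h)) {k : ℕ} (hk : k * h ≤ T)
    (hZ : ∀ j < k, c ≤ frozenEuler b c h x ξ j) :
    |frozenEuler b c h x ξ k - Y (k * h)| ≤ k * (h * (K * η)) := by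
  induction k with
  | zero => simp [frozenEuler, hY.apply_zero hT, hw]
  | succ k ih =>
    have hkT : k * h ≤ T := (by push_cast at hk; linarith)
    have ih := ih hkT fun j hj => hZ j (hj.trans k.lt_succ_self)
    have hck := hZ k k.lt_succ_self
    rw [frozenEuler_succ_of_le hck, hξ k, ← hbb' _ hck]
    set z := frozenEuler b c h x ξ k
    have hk0 : 0 ≤ k * h := by positivity
    have hle : k * h ≤ (k + 1) * h := by linarith
    have hk' : (k + 1) * h ≤ T := by exact_mod_cast hk
    have hinc := hY.sub_eq hk0 hle hk'
    have hloc : |(∫ r in (k * h)..((k + 1) * h), b' (Y r)) - h * b' (Y (k * h))| ≤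
        h * (K * η) := by
      have h1 : (∫ r in (k * h)..((k + 1) * h), b' (Y r)) - h * b' (Y (k * h)) =
          ∫ r in (k * h)..((k + 1) * h), (b' (Y r) - b' (Y (k * h))) := by
        rw [intervalIntegral.integral_sub (hY.intervalIntegrable_of_le hk0 hle hk') (by simp),
          intervalIntegral.integral_const, smul_eq_mul]
        ring
      rw [h1, ← Real.norm_eq_abs]
      refine (intervalIntegral.norm_integral_le_of_norm_le_const (C := K * η)
        fun r hr => ?_).trans ?_
      · rw [Set.uIoc_of_le hle] at hr
        refine (hlip _ _).trans (mul_le_mul_of_nonneg_left ?_ hK)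
        refine hosc r ⟨hk0.trans hr.1.le, hr.2.trans hk'⟩ _ ⟨hk0, hkT⟩ ?_
        rw [abs_of_nonneg (by linarith [hr.1])]
        linarith [hr.2]
      · rw [show (k + 1) * h - k * h = h by ring, abs_of_nonneg hh, mul_comm]
    -- For a nonincreasing `K`-Lipschitz drift and `h * K ≤ 1`, the map `z ↦ z + h * b' z` is
    -- nonexpansive, so earlier errors are not amplified.
    have hcontr : |z - Y (k * h) + h * (b' z - b' (Y (k * h)))| ≤ |z - Y (k * h)| := by
      have h2 := hlip z (Y (k * h))
      rcases le_total z (Y (k * h)) with hle' | hle'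
      · have h3 := hanti hle'
        rw [abs_of_nonpos (by linarith : z - Y (k * h) ≤ 0),
          abs_of_nonneg (by linarith : 0 ≤ b' z - b' (Y (k * h)))] at h2
        rw [abs_of_nonpos (by linarith : z - Y (k * h) ≤ 0), abs_le]
        have h4 : h * (b' z - b' (Y (k * h))) ≤ h * (K * -(z - Y (k * h))) := by gcongr
        have h5 : 0 ≤ h * (b' z - b' (Y (k * h))) := mul_nonneg hh (by linarith)
        have h6 : h * K * -(z - Y (k * h)) ≤ 1 * -(z - Y (k * h)) :=
          mul_le_mul_of_nonneg_right hhK (by linarith)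
        constructor <;> linarith
      · have h3 := hanti hle'
        rw [abs_of_nonneg (by linarith : 0 ≤ z - Y (k * h)),
          abs_of_nonpos (by linarith : b' z - b' (Y (k * h)) ≤ 0)] at h2
        rw [abs_of_nonneg (by linarith : 0 ≤ z - Y (k * h)), abs_le]
        have h4 : h * -(b' z - b' (Y (k * h))) ≤ h * (K * (z - Y (k * h))) := by gcongr
        have h5 : 0 ≤ h * -(b' z - b' (Y (k * h))) := mul_nonneg hh (by linarith)
        have h6 : h * K * (z - Y (k * h)) ≤ 1 * (z - Y (k * h)) :=
          mul_le_mul_of_nonneg_right hhK (by linarith)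
        constructor <;> linarith
    push_cast
    calc |z + h * b' z + (w ((k + 1) * h) - w (k * h)) - Y ((k + 1) * h)|
        = |(z - Y (k * h) + h * (b' z - b' (Y (k * h)))) -
          ((∫ r in (k * h)..((k + 1) * h), b' (Y r)) - h * b' (Y (k * h)))| := by
          congr 1
          linarith
      _ ≤ |z - Y (k * h)| + h * (K * η) := (abs_sub _ _).trans (add_le_add hcontr hloc)
      _ ≤ (k + 1) * (h * (K * η)) := by linarith

end frozenEuler

/-- The Euler scheme with `n` steps on `[0, T]` for the half-line equation, frozen below `c`. -/
def halfLineEuler (a c x T : ℝ) (w : ℝ → ℝ) (n : ℕ) : ℕ → ℝ :=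
  frozenEuler (halfLineDrift a) c (T / n) x fun k => w ((k + 1) * (T / n)) - w (k * (T / n))

/-- Uniform continuity of `Y` makes each local error at most `(T / n) * K * η'`, and up to `n` of
them sum to at most `T * K * η' ≤ η`. The estimate holds as long as the scheme has not been frozen.
-/
lemma eventually_abs_halfLineEuler_sub_le {a ε c x T : ℝ} {w Y : ℝ → ℝ} (ha : 0 < a) (hε : 0 < ε)
    (hεc : ε ≤ c) (hY : IsPathSolution (truncatedDrift a ε) x w T Y) (hw : w 0 = 0) (hT : 0 ≤ T)
    {η : ℝ} (hη : 0 < η) :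
    ∀ᶠ n : ℕ in atTop, ∀ k ≤ n, (∀ j < k, c ≤ halfLineEuler a c x T w n j) →
      |halfLineEuler a c x T w n k - Y (k * (T / n))| ≤ η := by
  set K := 1 / a + 1 / ε ^ 2 with hK
  have hK0 : 0 < K := by positivity
  set η' := η / (T * K + 1) with hη'
  have hTK : 0 < T * K + 1 := by positivity
  have hη0 : 0 < η' := by positivity
  obtain ⟨δ, hδ, hosc⟩ := Metric.uniformContinuousOn_iff.1
    (isCompact_Icc.uniformContinuousOn_of_continuous hY.continuousOn) η' hη0
  have hlim : Tendsto (fun n : ℕ => T / n) atTop (𝓝 0) := tendsto_const_div_atTop_nhds_zero_nat T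
  filter_upwards [hlim.eventually (gt_mem_nhds hδ),
    hlim.eventually (gt_mem_nhds (by positivity : 0 < 1 / K)), eventually_gt_atTop 0]
    with n hnδ hnK hn k hkn hZ
  have hn0 : (0 : ℝ) < n := by exact_mod_cast hn
  have hh : 0 ≤ T / n := by positivity
  have hkT : k * (T / n) ≤ T := by
    calc k * (T / n) ≤ n * (T / n) := by gcongr
      _ = T := by field_simp
  refine (abs_frozenEuler_sub_le (η := η') hY hw hT (truncatedDrift_anti ha hε) hK0.le
    (abs_truncatedDrift_sub_le ha hε) (fun z hz => truncatedDrift_of_le (hεc.trans hz)) hh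
    ((le_div_iff₀ hK0).1 hnK.le) (fun s hs t ht hst => ?_) (fun k => rfl) hkT hZ).trans ?_
  · have := hosc s hs t ht (by rw [Real.dist_eq]; linarith)
    rw [Real.dist_eq] at this
    exact this.le
  · calc k * (T / n * (K * η')) = (k * (T / n)) * (K * η') := by ring
      _ ≤ T * (K * η') := by gcongr
      _ = (T * K) / (T * K + 1) * η := by rw [hη']; ring
      _ ≤ 1 * η := by
        gcongr
        rw [div_le_one hTK]
        linarith
      _ = η := one_mul _

/-- If the truncated equation has a solution which goes below `c`, then the Euler schemes end up
below `c`. -/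
lemma eventually_halfLineEuler_lt {a ε c x T : ℝ} {w Y : ℝ → ℝ} (ha : 0 < a) (hε : 0 < ε)
    (hεc : ε ≤ c) (hY : IsPathSolution (truncatedDrift a ε) x w T Y) (hw : w 0 = 0) (hT : 0 ≤ T)
    {t : ℝ} (ht : t ∈ Set.Icc 0 T) (hlt : Y t < c) :
    ∀ᶠ n : ℕ in atTop, halfLineEuler a c x T w n n < c := by
  -- One third of the gap pays for the scheme error and one third for moving `t` to a grid point. A
  -- terminal value at least `c` would mean no freezing, so the error bound would apply at that grid
  -- point.
  set η := (c - Y t) / 3 with hη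
  have hη0 : 0 < η := by rw [hη]; linarith
  obtain ⟨δ, hδ, hosc⟩ := Metric.uniformContinuousOn_iff.1
    (isCompact_Icc.uniformContinuousOn_of_continuous hY.continuousOn) η hη0
  have hlim : Tendsto (fun n : ℕ => T / n) atTop (𝓝 0) := tendsto_const_div_atTop_nhds_zero_nat T
  filter_upwards [eventually_abs_halfLineEuler_sub_le ha hε hεc hY hw hT hη0,
    hlim.eventually (gt_mem_nhds hδ), eventually_gt_atTop 0] with n hn hnδ hnpos
  by_contra! hcon
  have hall : ∀ j ≤ n, c ≤ halfLineEuler a c x T w n j := fun j hj =>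
    le_frozenEuler_of_le hj hcon
  have hn0 : (0 : ℝ) < n := by exact_mod_cast hnpos
  obtain ⟨k, hkn, hk1, hk2⟩ : ∃ k ≤ n, k * (T / n) ≤ t ∧ t ≤ k * (T / n) + T / n := by
    rcases hT.eq_or_lt with rfl | hT0
    · exact ⟨0, n.zero_le, by simpa using ht.1, by simpa using ht.2⟩
    · have hh : 0 < T / n := by positivity
      refine ⟨⌊t / (T / n)⌋₊, ?_, ?_, ?_⟩
      · refine Nat.floor_le_of_le ?_
        rw [div_le_iff₀ hh]
        calc t ≤ T := ht.2
          _ = n * (T / n) := by field_simp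
      · exact (le_div_iff₀ hh).1 (Nat.floor_le (div_nonneg ht.1 hh.le))
      · have := (div_lt_iff₀ hh).1 (Nat.lt_floor_add_one (t / (T / n)))
        linarith
  have h1 := hn k hkn fun j hj => hall j (hj.le.trans hkn)
  have h2 := hosc (k * (T / n)) ⟨by positivity, hk1.trans ht.2⟩ t ht
    (by rw [Real.dist_eq, abs_of_nonpos (by linarith)]; linarith)
  rw [Real.dist_eq] at h2
  have h3 := hall k hkn
  have h4 := (abs_le.1 h1).2
  have h5 := (abs_lt.1 h2).2
  linarith

/-- The frozen Euler schemes converge to a positive solution. -/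
lemma IsPosSolution.tendsto_halfLineEuler {a ε c x T : ℝ} {w Y : ℝ → ℝ} (ha : 0 < a)
    (hY : IsPosSolution a x w T Y) (hw : w 0 = 0) (hT : 0 ≤ T) (hc : 0 < c) (hcε : c < ε)
    (hle : ∀ t ∈ Set.Icc 0 T, ε ≤ Y t) :
    Tendsto (fun n => halfLineEuler a c x T w n n) atTop (𝓝 (Y T)) := by
  have hY' : IsPathSolution (_root_.truncatedDrift a c) x w T Y :=
    hY.truncatedDrift hT fun t ht => hcε.le.trans (hle t ht)
  rw [Metric.tendsto_atTop']
  suffices ∀ η > 0, ∀ᶠ n : ℕ in atTop, dist (halfLineEuler a c x T w n n) (Y T) < η by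
    intro η hη
    obtain ⟨N, hN⟩ := eventually_atTop.1 (this η hη)
    exact ⟨N, fun n hn => hN n hn.le⟩
  intro η hη
  -- An error of at most `ε - c` keeps the scheme at or above `c`; by induction it is never frozen.
  have hmin : 0 < min (η / 2) (ε - c) := lt_min (by positivity) (by linarith)
  filter_upwards [eventually_abs_halfLineEuler_sub_le ha hc le_rfl hY' hw hT hmin,
    eventually_gt_atTop 0] with n hn hnpos
  have hn0 : (0 : ℝ) < n := by exact_mod_cast hnpos
  have hall : ∀ k ≤ n, ∀ j < k, c ≤ halfLineEuler a c x T w n j := by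
    intro k
    induction k with
    | zero => intro _ j hj; omega
    | succ k ih =>
      intro hk j hj
      have hk' : k ≤ n := by omega
      rcases Nat.lt_succ_iff_lt_or_eq.1 hj with hj' | rfl
      · exact ih hk' j hj'
      · have h1 := (abs_le.1 ((hn j hk' (ih hk')).trans (min_le_right _ _))).1
        have h2 := hle (j * (T / n)) ⟨by positivity, by
          calc j * (T / n) ≤ n * (T / n) := by gcongr
            _ = T := by field_simp⟩
        linarith
  have h3 := (hn n le_rfl (hall n le_rfl)).trans (min_le_left _ _)
  rw [show n * (T / n) = T by field_simp] at h3
  rw [Real.dist_eq]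
  linarith

/-! ### The supermartingale estimate for `1 / z` -/

/-- This is the second-order Taylor expansion of `1 / z` with a cubic remainder. If the truncation
is active, then `|y| ≥ ε`, and the remainder alone dominates `ε⁻¹`. -/
lemma inv_max_add_le {ε z y : ℝ} (hε : 0 < ε) (hz : 2 * ε ≤ z) :
    (max (z + y) ε)⁻¹ ≤ z⁻¹ - y / z ^ 2 + y ^ 2 / z ^ 3 + |y| ^ 3 / ε ^ 4 := by
  have hz0 : 0 < z := by linarith
  rcases le_total ε (z + y) with h | h
  · have hzy : 0 < z + y := hε.trans_le h
    rw [max_eq_left h]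
    have h1 : (z + y)⁻¹ = z⁻¹ - y / z ^ 2 + y ^ 2 / z ^ 3 - y ^ 3 / (z ^ 3 * (z + y)) := by
      field_simp
      ring
    have h2 : -(y ^ 3 / (z ^ 3 * (z + y))) ≤ |y| ^ 3 / ε ^ 4 := by
      rw [← neg_div]
      have h3 : -y ^ 3 ≤ |y| ^ 3 := by
        rw [← abs_pow]
        exact neg_le_abs _
      have h4 : ε ^ 4 ≤ z ^ 3 * (z + y) := by
        calc ε ^ 4 = ε ^ 3 * ε := by ring
          _ ≤ z ^ 3 * (z + y) := by gcongr; linarith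
      calc -y ^ 3 / (z ^ 3 * (z + y)) ≤ |y| ^ 3 / (z ^ 3 * (z + y)) := by gcongr
        _ ≤ |y| ^ 3 / ε ^ 4 := by gcongr
    linarith
  · rw [max_eq_right h]
    have hy : y ≤ -ε := by linarith
    have h1 : ε⁻¹ ≤ |y| ^ 3 / ε ^ 4 := by
      rw [inv_eq_one_div, div_le_div_iff₀ hε (by positivity)]
      have : ε ^ 3 ≤ |y| ^ 3 := by
        gcongr
        exact (by linarith : ε ≤ -y).trans (neg_le_abs y)
      calc 1 * ε ^ 4 = ε ^ 3 * ε := by ring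
        _ ≤ |y| ^ 3 * ε := by gcongr
    have h2 : 0 ≤ -y / z ^ 2 := div_nonneg (by linarith) (by positivity)
    have h3 : 0 ≤ z⁻¹ + y ^ 2 / z ^ 3 := by positivity
    rw [neg_div] at h2
    linarith

/-- One step of the Euler scheme frozen below `c`. -/
def eulerStep (a c h z y : ℝ) : ℝ := if z < c then z else z + h * halfLineDrift a z + y

lemma measurable_eulerStep (a c h : ℝ) : Measurable fun p : ℝ × ℝ => eulerStep a c h p.1 p.2 :=
  Measurable.ite (measurableSet_lt measurable_fst measurable_const) measurable_fst
    ((measurable_fst.add (((measurable_halfLineDrift a).comp measurable_fst).const_mul h)).add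
      measurable_snd)

lemma inv_max_mem_Icc {ε : ℝ} (hε : 0 < ε) (z : ℝ) : (max z ε)⁻¹ ∈ Set.Icc 0 ε⁻¹ :=
  ⟨inv_nonneg.2 (hε.le.trans (le_max_right _ _)), inv_anti₀ hε (le_max_right _ _)⟩

lemma integrable_inv_max {α : Type*} [MeasurableSpace α] {μ : Measure α} [IsFiniteMeasure μ]
    {ε : ℝ} (hε : 0 < ε) {f : α → ℝ} (hf : AEMeasurable f μ) :
    Integrable (fun p => (max (f p) ε)⁻¹) μ := by
  refine Integrable.of_bound (C := ε⁻¹)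
    (hf.max aemeasurable_const).inv.aestronglyMeasurable (ae_of_all _ fun p => ?_)
  rw [Real.norm_of_nonneg (inv_max_mem_Icc hε _).1]
  exact (inv_max_mem_Icc hε _).2

/-- Up to a higher order error, `1 / z` is a supermartingale for the Euler scheme, after
compensation by an exponential factor. -/
lemma exists_integral_eulerStep_le {a ε : ℝ} (ha : 0 < a) (hε : 0 < ε) :
    ∃ C, 0 ≤ C ∧ ∀ h, 0 ≤ h → h ≤ 1 → ∀ z,
      ∫ y, (max (eulerStep a (2 * ε) h z (√h * y)) ε)⁻¹ ∂(gaussianReal 0 1) ≤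
        (1 + h / (2 * a)) * (max z ε)⁻¹ + C * √h ^ 3 := by
  set M := ∫ y, |y| ^ 3 ∂(gaussianReal 0 1) with hM
  have hM0 : 0 ≤ M := integral_nonneg fun y => by positivity
  -- The terms bound, in order, the squared drift, the cubed drift and the cubed noise. The factors
  -- `4` come from `(u + v)³ ≤ 4 (u³ + v³)`.
  refine ⟨1 / ε ^ 5 + 4 / ε ^ 7 + 4 * M / ε ^ 4, by positivity, fun h hh hh1 z => ?_⟩
  set s := √h with hs
  have hs0 : 0 ≤ s := Real.sqrt_nonneg h
  have hs1 : s ≤ 1 := Real.sqrt_le_one.2 hh1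
  have hsq : s ^ 2 = h := Real.sq_sqrt hh
  rcases lt_or_ge z (2 * ε) with hz | hz
  · simp only [eulerStep, if_pos hz, integral_const, probReal_univ, one_smul]
    have h1 : 0 ≤ h / (2 * a) * (max z ε)⁻¹ :=
      mul_nonneg (by positivity) (inv_max_mem_Icc hε z).1
    have h2 : 0 ≤ (1 / ε ^ 5 + 4 / ε ^ 7 + 4 * M / ε ^ 4) * s ^ 3 := by positivity
    linarith
  · have hz0 : 0 < z := by linarith
    have hεz : ε ≤ z := by linarith
    simp only [eulerStep, if_neg (not_lt.2 hz)]
    rw [max_eq_left hεz]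
    set β := halfLineDrift a z with hβ
    have hβ0 : 0 < β := halfLineDrift_pos ha hz0
    have hβε : β ≤ ε⁻¹ := (halfLineDrift_le_inv ha hz0).trans (inv_anti₀ hε hεz)
    have i1 : Integrable (fun y : ℝ => y) (gaussianReal 0 1) :=
      (memLp_id_gaussianReal 1).integrable (by simp)
    have i2 : Integrable (fun y : ℝ => y ^ 2) (gaussianReal 0 1) :=
      (memLp_id_gaussianReal 2).integrable_sq
    have i3 : Integrable (fun y : ℝ => |y| ^ 3) (gaussianReal 0 1) := by
      have := (memLp_id_gaussianReal (μ := 0) (v := 1) 3).integrable_norm_pow (by norm_num)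
      simpa only [id_eq, Real.norm_eq_abs] using this
    have e1 : ∫ y : ℝ, y ∂(gaussianReal 0 1) = 0 := integral_id_gaussianReal
    have e2 : ∫ y : ℝ, y ^ 2 ∂(gaussianReal 0 1) = 1 := by
      have h1 := variance_id_gaussianReal (μ := 0) (v := 1)
      rw [variance_of_integral_eq_zero aemeasurable_id (by simp)] at h1
      simpa using h1
    set A := z⁻¹ - h * β / z ^ 2 + (h * β) ^ 2 / z ^ 3 + 4 * (h * β) ^ 3 / ε ^ 4 with hA
    set B := -s / z ^ 2 + 2 * (h * β) * s / z ^ 3 with hB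
    have hpt : ∀ y : ℝ, (max (z + h * β + s * y) ε)⁻¹ ≤
        A + B * y + h / z ^ 3 * y ^ 2 + 4 * s ^ 3 / ε ^ 4 * |y| ^ 3 := by
      intro y
      have h1 := inv_max_add_le (y := h * β + s * y) hε hz
      rw [← add_assoc] at h1
      refine h1.trans ?_
      have h2 : |h * β + s * y| ^ 3 ≤ 4 * ((h * β) ^ 3 + s ^ 3 * |y| ^ 3) := by
        have h3 : |h * β + s * y| ≤ h * β + s * |y| := by
          refine (abs_add_le _ _).trans_eq ?_
          rw [abs_mul, abs_mul, abs_of_nonneg hh, abs_of_pos hβ0, abs_of_nonneg hs0]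
        have h4 := add_pow_le (by positivity : 0 ≤ h * β) (by positivity : 0 ≤ s * |y|) 3
        rw [mul_pow s] at h4
        norm_num at h4
        exact (pow_le_pow_left₀ (abs_nonneg _) h3 3).trans h4
      have h5 : |h * β + s * y| ^ 3 / ε ^ 4 ≤
          4 * ((h * β) ^ 3 + s ^ 3 * |y| ^ 3) / ε ^ 4 := by gcongr
      have h6 : (h * β + s * y) ^ 2 / z ^ 3 =
          (h * β) ^ 2 / z ^ 3 + 2 * (h * β) * s / z ^ 3 * y + h / z ^ 3 * y ^ 2 := by
        rw [← hsq]
        ring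
      have h7 : 4 * ((h * β) ^ 3 + s ^ 3 * |y| ^ 3) / ε ^ 4 =
          4 * (h * β) ^ 3 / ε ^ 4 + 4 * s ^ 3 / ε ^ 4 * |y| ^ 3 := by ring
      have h8 : (h * β + s * y) / z ^ 2 = h * β / z ^ 2 + s / z ^ 2 * y := by ring
      rw [h6, h8]
      rw [h7] at h5
      rw [hA, hB, neg_div]
      linarith
    have j1 : Integrable (fun y : ℝ => A + B * y) (gaussianReal 0 1) :=
      (integrable_const A).add (i1.const_mul B)
    have j2 : Integrable (fun y : ℝ => A + B * y + h / z ^ 3 * y ^ 2) (gaussianReal 0 1) :=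
      j1.add (i2.const_mul _)
    have hint := integral_mono (μ := gaussianReal 0 1)
      (integrable_inv_max hε (f := fun y => z + h * β + s * y) (by fun_prop))
      (j2.add (i3.const_mul (4 * s ^ 3 / ε ^ 4))) hpt
    refine hint.trans ?_
    simp only [Pi.add_apply]
    rw [integral_add j2 (i3.const_mul _), integral_add j1 (i2.const_mul _),
      integral_add (integrable_const A) (i1.const_mul B), integral_const_mul, integral_const_mul,
      integral_const_mul, e1, e2, ← hM, integral_const, probReal_univ, one_smul]
    -- The order-`h` terms: `h / z ^ 3` comes from the noise variance, and the `1/z` part of the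
    -- drift cancels it. The deficit `z / (2 * a)` leaves the Gronwall rate `1 / (2 * a)`.
    have k1 : h / z ^ 3 - h * β / z ^ 2 ≤ h / (2 * a) * z⁻¹ := by
      have h1 := le_halfLineDrift ha hz0
      have h2 : h * (z⁻¹ - z / (2 * a)) / z ^ 2 ≤ h * β / z ^ 2 := by gcongr
      have h3 : h * (z⁻¹ - z / (2 * a)) / z ^ 2 = h / z ^ 3 - h / (2 * a) * z⁻¹ := by
        field_simp
      linarith
    have hs4 : h ^ 2 ≤ s ^ 3 := by
      calc h ^ 2 = s ^ 3 * s := by rw [← hsq]; ring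
        _ ≤ s ^ 3 * 1 := by gcongr
        _ = s ^ 3 := mul_one _
    have hs6 : h ^ 3 ≤ s ^ 3 := by
      calc h ^ 3 = h ^ 2 * h := by ring
        _ ≤ s ^ 3 * 1 := by gcongr
        _ = s ^ 3 := mul_one _
    have k2 : (h * β) ^ 2 / z ^ 3 ≤ 1 / ε ^ 5 * s ^ 3 := by
      calc (h * β) ^ 2 / z ^ 3 = h ^ 2 * β ^ 2 / z ^ 3 := by ring
        _ ≤ s ^ 3 * (ε⁻¹) ^ 2 / ε ^ 3 := by gcongr
        _ = 1 / ε ^ 5 * s ^ 3 := by field_simp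
    have k3 : 4 * (h * β) ^ 3 / ε ^ 4 ≤ 4 / ε ^ 7 * s ^ 3 := by
      calc 4 * (h * β) ^ 3 / ε ^ 4 = 4 * (h ^ 3 * β ^ 3) / ε ^ 4 := by ring
        _ ≤ 4 * (s ^ 3 * (ε⁻¹) ^ 3) / ε ^ 4 := by gcongr
        _ = 4 / ε ^ 7 * s ^ 3 := by field_simp
    have k4 : 4 * s ^ 3 / ε ^ 4 * M = 4 * M / ε ^ 4 * s ^ 3 := by ring
    rw [hA, k4]
    linarith

/-- The Euler scheme as a functional of a path on `[0, t]`. -/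
def eulerFunctional (a c x : ℝ) (h t : ℝ≥0) (k : ℕ) (p : Set.Iic t → ℝ) : ℝ :=
  frozenEuler (halfLineDrift a) c h x (fun j =>
    if hj : ((j : ℝ≥0) + 1) * h ≤ t then
      p ⟨((j : ℝ≥0) + 1) * h, hj⟩ -
        p ⟨(j : ℝ≥0) * h, (mul_le_mul_left (le_add_of_nonneg_right zero_le) h).trans hj⟩
    else 0) k

lemma measurable_eulerFunctional (a c x : ℝ) (h t : ℝ≥0) (k : ℕ) :
    Measurable (eulerFunctional a c x h t k) := by
  refine measurable_frozenEuler (measurable_halfLineDrift a) (fun j => ?_) k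
  split_ifs with hj
  · exact (measurable_pi_apply _).sub (measurable_pi_apply _)
  · exact measurable_const

lemma halfLineEuler_eq_eulerFunctional {a c x : ℝ} {T t : ℝ≥0} {n k : ℕ} (f : ℝ≥0 → ℝ)
    (hk : k * (T / n) ≤ t) :
    halfLineEuler a c x T (fun s => f s.toNNReal) n k =
      eulerFunctional a c x (T / n) t k (fun s => f s) := by
  unfold halfLineEuler eulerFunctional
  rw [NNReal.coe_div, NNReal.coe_natCast]
  refine frozenEuler_congr fun j hj => ?_
  have h1 : ((j : ℝ≥0) + 1) * (T / n) ≤ t := by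
    refine le_trans ?_ hk
    gcongr
    exact_mod_cast hj
  have h2 : ((j + 1) * ((T : ℝ) / n)).toNNReal = ((j : ℝ≥0) + 1) * (T / n) := by
    rw [← Real.toNNReal_coe (r := ((j : ℝ≥0) + 1) * (T / n))]
    push_cast
    rfl
  have h3 : (j * ((T : ℝ) / n)).toNNReal = (j : ℝ≥0) * (T / n) := by
    rw [← Real.toNNReal_coe (r := (j : ℝ≥0) * (T / n))]
    push_cast
    rfl
  rw [dif_pos h1]
  simp only [h2, h3]

/-! ### Brownian paths are almost surely non-hitting -/

section Brownian

variable {Ω : Type*} [MeasurableSpace Ω] {P : Measure Ω} {B : ℝ≥0 → Ω → ℝ}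

/-- The increment after `t` is independent of the path up to `t` and distributed as `√h` times a
standard Gaussian, so Fubini turns the one-step bound into one for expectations. -/
lemma integral_eulerStep_le [IsProbabilityMeasure P] (hB : IsPreBrownianReal B P) {a ε C : ℝ} (hε : 0 < ε)
    {h t : ℝ≥0} (hC : ∀ z,
      ∫ y, (max (eulerStep a (2 * ε) h z (√(h : ℝ) * y)) ε)⁻¹ ∂(gaussianReal 0 1) ≤
        (1 + h / (2 * a)) * (max z ε)⁻¹ + C * √(h : ℝ) ^ 3)
    {Ψ : (Set.Iic t → ℝ) → ℝ} (hΨ : Measurable Ψ)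
    (hΨm : AEMeasurable (fun ω => Ψ fun s => B s ω) P) :
    ∫ ω, (max (eulerStep a (2 * ε) h (Ψ fun s => B s ω) (B (t + h) ω - B t ω)) ε)⁻¹ ∂P ≤
      (1 + h / (2 * a)) * ∫ ω, (max (Ψ fun s => B s ω) ε)⁻¹ ∂P + C * √(h : ℝ) ^ 3 := by
  have hind : IndepFun (fun ω => Ψ fun s => B s ω) (fun ω => B (t + h) ω - B t ω) P :=
    ((hB.indepFun_shift t).comp (φ := fun p : ℝ≥0 → ℝ => p h) (ψ := Ψ) (by fun_prop) hΨ).symm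
  have hlaw := (hB.shift t).hasLaw_eval h
  set Z := fun ω => Ψ fun s => B s ω with hZ
  set ξ := fun ω => B (t + h) ω - B t ω with hξ
  have hprod := (indepFun_iff_map_prod_eq_prod_map_map hΨm hlaw.aemeasurable).1 hind
  have : IsProbabilityMeasure (P.map Z) := Measure.isProbabilityMeasure_map hΨm
  have hmeas : Measurable fun p : ℝ × ℝ => (max (eulerStep a (2 * ε) h p.1 p.2) ε)⁻¹ :=
    ((measurable_eulerStep a (2 * ε) h).max measurable_const).inv
  have h1 : ∫ ω, (max (eulerStep a (2 * ε) h (Z ω) (ξ ω)) ε)⁻¹ ∂P =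
      ∫ p, (max (eulerStep a (2 * ε) h p.1 p.2) ε)⁻¹ ∂((P.map Z).prod (gaussianReal 0 h)) := by
    rw [← hlaw.map_eq, ← hprod,
      integral_map (hΨm.prodMk hlaw.aemeasurable) hmeas.aestronglyMeasurable]
  have hgauss : gaussianReal 0 h = (gaussianReal 0 1).map (√(h : ℝ) * ·) := by
    rw [gaussianReal_map_const_mul]
    congr 1
    · simp
    · ext
      simp
  have h2 : ∀ z, ∫ y, (max (eulerStep a (2 * ε) h z y) ε)⁻¹ ∂(gaussianReal 0 h) ≤
      (1 + h / (2 * a)) * (max z ε)⁻¹ + C * √(h : ℝ) ^ 3 := fun z => by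
    have hz : Measurable fun y => (max (eulerStep a (2 * ε) h z y) ε)⁻¹ :=
      hmeas.comp measurable_prodMk_left
    rw [hgauss, integral_map (by fun_prop) hz.aestronglyMeasurable]
    exact hC z
  have hInt := integrable_inv_max hε (μ := (P.map Z).prod (gaussianReal 0 h))
    (measurable_eulerStep a (2 * ε) h).aemeasurable
  have hIntV : Integrable (fun z => (max z ε)⁻¹) (P.map Z) := integrable_inv_max hε aemeasurable_id
  rw [h1, integral_prod _ hInt]
  refine (integral_mono hInt.integral_prod_left
    ((hIntV.const_mul _).add (integrable_const _)) h2).trans_eq ?_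
  simp only [Pi.add_apply]
  rw [integral_add (hIntV.const_mul _) (integrable_const _), integral_const_mul, integral_const,
    probReal_univ, one_smul, integral_map hΨm hIntV.aestronglyMeasurable]

lemma aemeasurable_halfLineEuler (hB : IsPreBrownianReal B P) (a c x T : ℝ) (n k : ℕ) :
    AEMeasurable (fun ω => halfLineEuler a c x T (fun s => B s.toNNReal ω) n k) P := by
  have hξ : ∀ j : ℕ, AEMeasurable (fun ω => B ((j + 1) * (T / n)).toNNReal ω -
      B (j * (T / n)).toNNReal ω) P := fun j => (hB.aemeasurable _).sub (hB.aemeasurable _)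
  refine ⟨fun ω => frozenEuler (halfLineDrift a) c (T / n) x (fun j => (hξ j).mk _ ω) k,
    measurable_frozenEuler (measurable_halfLineDrift a) (fun j => (hξ j).measurable_mk) k, ?_⟩
  filter_upwards [ae_all_iff.2 fun j => (hξ j).ae_eq_mk] with ω hω
  exact frozenEuler_congr fun j _ => hω j

/-- Discrete Gronwall for the expectation of `1 / max Z ε`, then Markov at level `1 / (2ε)`. The `n`
errors of order `(T / n)^(3/2)` add up to order `√(T / n)`, which vanishes as `n → ∞`. -/
lemma measureReal_halfLineEuler_lt_le [IsProbabilityMeasure P] (hB : IsPreBrownianReal B P) {a ε C x : ℝ} (ha : 0 < a)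
    (hε : 0 < ε) (hεx : ε ≤ x) (hC0 : 0 ≤ C) (hC : ∀ h, 0 ≤ h → h ≤ 1 → ∀ z,
      ∫ y, (max (eulerStep a (2 * ε) h z (√h * y)) ε)⁻¹ ∂(gaussianReal 0 1) ≤
        (1 + h / (2 * a)) * (max z ε)⁻¹ + C * √h ^ 3) {T : ℝ≥0} {n : ℕ} (hn : 0 < n)
    (hTn : T ≤ n) :
    P.real {ω | halfLineEuler a (2 * ε) x T (fun s => B s.toNNReal ω) n n < 2 * ε} ≤
      2 * ε * ((x⁻¹ + T * (C * √(T / n : ℝ))) * Real.exp (T / (2 * a))) := by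
  have hn0 : (0 : ℝ) < n := by exact_mod_cast hn
  set h : ℝ≥0 := T / n with hh
  have hcoe : (h : ℝ) = T / n := by rw [hh]; push_cast; rfl
  have hnh : n * (h : ℝ) = T := by rw [hcoe]; field_simp
  have hle1 : (h : ℝ) ≤ 1 := by
    rw [hcoe, div_le_one hn0]
    exact_mod_cast hTn
  set u : ℕ → ℝ := fun k =>
    ∫ ω, (max (halfLineEuler a (2 * ε) x T (fun s => B s.toNNReal ω) n k) ε)⁻¹ ∂P with hu
  have hu0 : u 0 = x⁻¹ := by
    simp [hu, halfLineEuler, frozenEuler, max_eq_left hεx]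
  have hstep : ∀ k, u (k + 1) ≤ (1 + h / (2 * a)) * u k + C * √(h : ℝ) ^ 3 := by
    intro k
    have heq : ∀ ω, halfLineEuler a (2 * ε) x T (fun s => B s.toNNReal ω) n k =
        eulerFunctional a (2 * ε) x h (k * h) k (fun s => B s ω) := fun ω =>
      halfLineEuler_eq_eulerFunctional (fun s => B s ω) le_rfl
    have hΨm : AEMeasurable (fun ω => eulerFunctional a (2 * ε) x h (k * h) k
        fun s => B s ω) P := by
      simp_rw [← heq]
      exact aemeasurable_halfLineEuler hB _ _ _ _ _ _
    have := integral_eulerStep_le hB hε (hC h h.2 hle1)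
      (measurable_eulerFunctional a (2 * ε) x h (k * h) k) hΨm
    simp_rw [← heq] at this
    refine (le_of_eq ?_).trans this
    simp only [hu]
    congr 1
    ext ω
    congr 2
    have h2 : ((k + 1) * ((T : ℝ) / n)).toNNReal = k * h + h := by
      rw [← Real.toNNReal_coe (r := k * h + h)]
      congr 1
      push_cast
      rw [hcoe]
      ring
    have h3 : (k * ((T : ℝ) / n)).toNNReal = k * h := by
      rw [← Real.toNNReal_coe (r := k * h)]
      congr 1
    unfold eulerStep
    rw [hcoe, ← h2, ← h3]
    split_ifs with hlt
    · exact frozenEuler_succ_of_lt hlt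
    · rw [halfLineEuler, frozenEuler_succ_of_le (not_lt.1 hlt)]
  have hgron := discrete_gronwall (u := u) (n₀ := 0) (c := fun _ => h / (2 * a))
    (b := fun _ => C * √(h : ℝ) ^ 3) (by rw [hu0]; exact inv_nonneg.2 (hε.le.trans hεx))
    (fun k _ => hstep k) (fun _ _ => by positivity) (fun _ _ => by positivity) (Nat.zero_le n)
  have hs3 : n * (C * √(h : ℝ) ^ 3) = T * (C * √(T / n : ℝ)) := by
    have : √(h : ℝ) ^ 3 = h * √(h : ℝ) := by
      rw [pow_succ, Real.sq_sqrt h.coe_nonneg]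
    rw [this, ← hcoe, ← hnh]
    ring
  have hexp : n * ((h : ℝ) / (2 * a)) = T / (2 * a) := by rw [← hnh]; ring
  simp only [Finset.sum_const, Nat.card_Ico, Nat.sub_zero, nsmul_eq_mul, hu0, hs3, hexp] at hgron
  have hmarkov := mul_meas_ge_le_integral_of_nonneg (μ := P)
    (f := fun ω => (max (halfLineEuler a (2 * ε) x T (fun s => B s.toNNReal ω) n n) ε)⁻¹)
    (ae_of_all _ fun ω => (inv_max_mem_Icc hε _).1)
    (integrable_inv_max hε (aemeasurable_halfLineEuler hB _ _ _ _ _ _)) (2 * ε)⁻¹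
  have hsub : P.real {ω | halfLineEuler a (2 * ε) x T (fun s => B s.toNNReal ω) n n < 2 * ε} ≤
      P.real {ω | (2 * ε)⁻¹ ≤
        (max (halfLineEuler a (2 * ε) x T (fun s => B s.toNNReal ω) n n) ε)⁻¹} :=
    measureReal_mono fun ω hω =>
      inv_anti₀ (lt_max_of_lt_right hε) (max_le (le_of_lt hω) (by linarith))
  have hpos : 0 < 2 * ε := by positivity
  rw [inv_mul_le_iff₀ hpos] at hmarkov
  exact hsub.trans (hmarkov.trans (mul_le_mul_of_nonneg_left hgron hpos.le))

/-- Almost surely, the half-line equation driven by a Brownian motion has a positive solution. -/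
lemma ae_exists_isPosSolution [IsProbabilityMeasure P] (hB : IsBrownianReal B P) {a x : ℝ} (ha : 0 < a) (hx : 0 < x)
    (T : ℝ≥0) : ∀ᵐ ω ∂P, ∃ Y, IsPosSolution a x (fun s => B s.toNNReal ω) T Y := by
  set S : Set Ω := {ω | Continuous (B · ω) ∧ B 0 ω = 0 ∧
    ¬ ∃ Y, IsPosSolution a x (fun s => B s.toNNReal ω) T Y} with hS
  have hbound : ∀ ε, 0 < ε → ε ≤ x →
      P S ≤ ENNReal.ofReal (2 * ε * (x⁻¹ * Real.exp (T / (2 * a)))) := by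
    intro ε hε hεx
    obtain ⟨C, hC0, hC⟩ := exists_integral_eulerStep_le ha hε
    set E : ℕ → Set Ω := fun n =>
      {ω | halfLineEuler a (2 * ε) x T (fun s => B s.toNNReal ω) n n < 2 * ε} with hE
    -- Without a positive solution the `ε`-truncated one must drop below `2ε`, and then all
    -- sufficiently fine schemes end below `2ε`. The bounds used for `P S` need no measurability of
    -- `S` or `E n`.
    have hsub : S ⊆ ⋃ N, ⋂ n, ⋂ (_ : N ≤ n), E n := by
      rintro ω ⟨hcont, h0, hno⟩
      obtain ⟨Y, hY⟩ := exists_isPathSolution_truncatedDrift ha hε x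
        (hcont.comp continuous_real_toNNReal) T.2
      have : ∃ t ∈ Set.Icc (0 : ℝ) T, Y t < 2 * ε := by
        by_contra! hcon
        exact hno ⟨Y, hY.isPosSolution_of_truncatedDrift hε T.2
          fun t ht => (by linarith : ε ≤ 2 * ε).trans (hcon t ht)⟩
      obtain ⟨t, ht, hlt⟩ := this
      obtain ⟨N, hN⟩ := eventually_atTop.1 (eventually_halfLineEuler_lt ha hε
        (by linarith : ε ≤ 2 * ε) hY (by simpa using h0) T.2 ht hlt)
      simp only [Set.mem_iUnion, Set.mem_iInter]
      exact ⟨N, hN⟩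
    have hmono : Monotone fun N => ⋂ n, ⋂ (_ : N ≤ n), E n := fun M N hMN =>
      Set.iInter_mono fun n => Set.iInter_mono' fun h => ⟨hMN.trans h, le_rfl⟩
    refine (measure_mono hsub).trans ?_
    rw [hmono.measure_iUnion]
    refine iSup_le fun N => ?_
    have hlim : Tendsto (fun n : ℕ => ENNReal.ofReal (2 * ε *
        ((x⁻¹ + T * (C * √(T / n : ℝ))) * Real.exp (T / (2 * a))))) atTop
        (𝓝 (ENNReal.ofReal (2 * ε * (x⁻¹ * Real.exp (T / (2 * a)))))) := by
      refine (ENNReal.continuous_ofReal.tendsto _).comp ?_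
      have h1 : Tendsto (fun n : ℕ => √(T / n : ℝ)) atTop (𝓝 0) := by
        simpa using (tendsto_const_div_atTop_nhds_zero_nat (T : ℝ)).sqrt
      simpa using (((((h1.const_mul C).const_mul (T : ℝ)).const_add x⁻¹).mul_const
        (Real.exp (T / (2 * a)))).const_mul (2 * ε))
    refine ge_of_tendsto hlim ?_
    obtain ⟨m, hm⟩ := exists_nat_ge T
    filter_upwards [eventually_ge_atTop N, eventually_ge_atTop m, eventually_gt_atTop 0]
      with n hNn hmn hn
    have hTn : T ≤ n := hm.trans (by exact_mod_cast hmn)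
    refine (measure_mono (Set.iInter₂_subset n hNn)).trans ?_
    rw [← ofReal_measureReal]
    exact ENNReal.ofReal_le_ofReal (measureReal_halfLineEuler_lt_le hB.toIsPreBrownianReal ha hε
      hεx hC0 hC hn hTn)
  have hzero : P S = 0 := by
    have hlim : Tendsto (fun ε : ℝ => ENNReal.ofReal (2 * ε * (x⁻¹ * Real.exp (T / (2 * a)))))
        (𝓝[>] 0) (𝓝 0) := by
      have h1 : Continuous fun ε : ℝ =>
          ENNReal.ofReal (2 * ε * (x⁻¹ * Real.exp (T / (2 * a)))) :=
        ENNReal.continuous_ofReal.comp (by fun_prop)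
      have h2 := h1.tendsto 0
      simp only [mul_zero, zero_mul, ENNReal.ofReal_zero] at h2
      exact h2.mono_left nhdsWithin_le_nhds
    refine nonpos_iff_eq_zero.1 (ge_of_tendsto hlim ?_)
    filter_upwards [Ioc_mem_nhdsGT hx] with ε hε using hbound ε hε.1 hε.2
  have hnot : ∀ᵐ ω ∂P, ω ∉ S := measure_eq_zero_iff_ae_notMem.1 hzero
  filter_upwards [hnot, hB.cont, hB.eval_zero_ae_eq_zero] with ω hω hcont h0
  by_contra hno
  exact hω ⟨hcont, h0, hno⟩

/-- Almost every Brownian path is non-hitting. -/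
lemma ae_isNonHittingPath [IsProbabilityMeasure P] (hB : IsBrownianReal B P) :
    ∀ᵐ ω ∂P, IsNonHittingPath fun s => B s.toNNReal ω := by
  -- Countably many data suffice, since comparison passes to larger `a` and `x` and restriction to
  -- smaller `T`.
  have h1 : ∀ q : ℚ≥0, ∀ k m T : ℕ, ∀ᵐ ω ∂P, ∃ Y,
      IsPosSolution (1 / ((k : ℝ) + 1)) (1 / ((m : ℝ) + 1))
        (fun s => B ((q : ℝ≥0) + s.toNNReal) ω - B q ω) (T : ℝ≥0) Y := fun q k m T =>
    ae_exists_isPosSolution (hB.shift q) (by positivity) (by positivity) T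
  filter_upwards [ae_all_iff.2 fun q => ae_all_iff.2 fun k => ae_all_iff.2 fun m =>
    ae_all_iff.2 fun T => h1 q k m T, hB.cont, hB.eval_zero_ae_eq_zero] with ω hω hcont h0
  have hw : Continuous fun s : ℝ => B s.toNNReal ω := hcont.comp continuous_real_toNNReal
  refine ⟨hw, by simpa using h0, fun q a x T ha hx hT => ?_⟩
  obtain ⟨k, hk⟩ := exists_nat_one_div_lt ha
  obtain ⟨m, hm⟩ := exists_nat_one_div_lt hx
  obtain ⟨N, hN⟩ := exists_nat_ge T
  obtain ⟨Y, hY⟩ := hω q k m N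
  have hpath : ∀ s ∈ Set.Icc 0 T, B (((q : ℝ) + s).toNNReal) ω - B (q : ℝ).toNNReal ω =
      B ((q : ℝ≥0) + s.toNNReal) ω - B q ω := fun s hs => by
    have hq : (q : ℝ).toNNReal = (q : ℝ≥0) := by
      exact Real.toNNReal_coe (r := (q : ℝ≥0))
    rw [Real.toNNReal_add (by positivity) hs.1, hq]
  obtain ⟨Y', hY'⟩ := (hY.mono_time hT (by simpa using hN)).exists_of_le (by positivity) hk.le
    hm.le hT ((hcont.comp (continuous_const.add continuous_real_toNNReal)).sub continuous_const)
  refine ⟨Y', ⟨hY'.1.continuousOn, hY'.1.intervalIntegrable, fun t ht => ?_⟩, hY'.2⟩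
  rw [hpath t ht]
  exact hY'.1.eq t ht

end Brownian

/-! ### Brownian motion is unbounded below -/

section Unbounded

variable {Ω : Type*} [MeasurableSpace Ω] {P : Measure Ω} [IsProbabilityMeasure P]
  {B : ℝ≥0 → Ω → ℝ}

lemma gaussianReal_real_Ioi_neg_one_lt_one : (gaussianReal 0 1).real (Set.Ioi (-1)) < 1 := by
  rw [← Set.compl_Iic, probReal_compl_eq_one_sub measurableSet_Iic]
  have h : (gaussianReal 0 1) (Set.Iic (-1)) ≠ 0 := fun h => by
    have := gaussianReal_absolutelyContinuous' 0 one_ne_zero h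
    simp at this
  have : 0 < (gaussianReal 0 1).real (Set.Iic (-1)) :=
    ENNReal.toReal_pos h (measure_ne_top _ _)
  linarith

lemma gaussianReal_real_Ioi_neg_sqrt {v : ℝ≥0} (hv : 0 < v) :
    (gaussianReal 0 v).real (Set.Ioi (-√(v : ℝ))) = (gaussianReal 0 1).real (Set.Ioi (-1)) := by
  have hs : 0 < √(v : ℝ) := Real.sqrt_pos.2 hv
  have hgauss : gaussianReal 0 v = (gaussianReal 0 1).map (√(v : ℝ) * ·) := by
    rw [gaussianReal_map_const_mul]
    congr 1
    · simp
    · ext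
      simp
  rw [hgauss, map_measureReal_apply (by fun_prop) measurableSet_Ioi]
  congr 1
  ext y
  simp only [Set.mem_preimage, Set.mem_Ioi]
  constructor <;> intro h <;> nlinarith

/-- Staying above a level gets less likely, by a fixed factor, after a sufficiently long time. -/
lemma exists_measureReal_forall_ge_le (hB : IsPreBrownianReal B P) (c : ℝ) (I : Finset ℝ≥0)
    {δ : ℝ} (hδ : 0 < δ) : ∃ J : Finset ℝ≥0, P.real {ω | ∀ s ∈ J, c ≤ B s ω} ≤
      P.real {ω | ∀ s ∈ I, c ≤ B s ω} * (gaussianReal 0 1).real (Set.Ioi (-1)) + δ := by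
  set t := I.sup id with ht
  have hIt : ∀ s ∈ I, s ≤ t := fun s hs => Finset.le_sup (f := id) hs
  set m := ∫ ω, |B t ω| ∂P with hm
  have hm0 : 0 ≤ m := integral_nonneg fun _ => abs_nonneg _
  set R := (m + 1) / δ with hR
  have hR0 : 0 < R := by positivity
  have htail : P.real {ω | R ≤ |B t ω|} ≤ δ := by
    have := mul_meas_ge_le_integral_of_nonneg (μ := P) (f := fun ω => |B t ω|)
      (ae_of_all _ fun _ => abs_nonneg _) (hB.integrable_eval t).abs R
    have h2 : R * δ = m + 1 := by rw [hR]; field_simp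
    have h3 : R * P.real {ω | R ≤ |B t ω|} ≤ R * δ := by
      rw [h2]
      exact this.trans (by linarith)
    exact le_of_mul_le_mul_left h3 hR0
  -- When `|B t| < R`, an increment of at most `-√v` over time `v` ends below `c`. The complementary
  -- event is independent of the past, and by scaling its probability does not depend on `v`.
  obtain ⟨v, hv0, hv⟩ : ∃ v : ℝ≥0, 0 < v ∧ R + |c| < √(v : ℝ) := by
    have h1 : 0 < R + |c| + 1 := by positivity
    refine ⟨((R + |c| + 1) ^ 2).toNNReal, Real.toNNReal_pos.2 (pow_pos h1 2), ?_⟩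
    rw [Real.coe_toNNReal _ (by positivity), Real.sqrt_sq h1.le]
    linarith
  have hlaw := (hB.shift t).hasLaw_eval v
  set S : Set (Set.Iic t → ℝ) := ⋂ s : I, {p | c ≤ p ⟨s, hIt s s.2⟩} with hS
  have hSm : MeasurableSet S := MeasurableSet.iInter fun s =>
    measurableSet_le measurable_const (measurable_pi_apply _)
  have hSeq : (fun ω (s : Set.Iic t) => B s ω) ⁻¹' S = {ω | ∀ s ∈ I, c ≤ B s ω} := by
    ext ω
    simp [hS]
  have hmul := (hB.indepFun_shift t).symm.measure_inter_preimage_eq_mul S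
    ((fun p : ℝ≥0 → ℝ => p v) ⁻¹' Set.Ioi (-√(v : ℝ))) hSm
    ((measurable_pi_apply v) measurableSet_Ioi)
  rw [hSeq] at hmul
  set E := (fun ω t_1 => B (t + t_1) ω - B t ω) ⁻¹'
    ((fun p : ℝ≥0 → ℝ => p v) ⁻¹' Set.Ioi (-√(v : ℝ))) with hE
  have hPE : P.real E = (gaussianReal 0 1).real (Set.Ioi (-1)) := by
    rw [← gaussianReal_real_Ioi_neg_sqrt hv0, ← hlaw.map_eq,
      map_measureReal_apply_of_aemeasurable hlaw.aemeasurable measurableSet_Ioi]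
    rfl
  have hmul' : P.real ({ω | ∀ s ∈ I, c ≤ B s ω} ∩ E) =
      P.real {ω | ∀ s ∈ I, c ≤ B s ω} * (gaussianReal 0 1).real (Set.Ioi (-1)) := by
    rw [← hPE, measureReal_def, hmul, ENNReal.toReal_mul]
    rfl
  refine ⟨insert (t + v) I, ?_⟩
  rw [← hmul']
  refine (measureReal_mono (fun ω hω => ?_)).trans
    ((measureReal_union_le _ {ω | R ≤ |B t ω|}).trans (add_le_add le_rfl htail))
  by_cases hω' : R ≤ |B t ω|
  · exact Or.inr hω'
  · left
    refine ⟨fun s hs => hω s (Finset.mem_insert_of_mem hs), ?_⟩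
    have h1 := hω (t + v) (Finset.mem_insert_self _ _)
    have h2 := (le_abs_self (B t ω)).trans_lt (not_le.1 hω')
    have h3 := neg_abs_le c
    change -√(v : ℝ) < B (t + v) ω - B t ω
    linarith

/-- Brownian motion is almost surely unbounded below. -/
lemma ae_forall_exists_lt (hB : IsPreBrownianReal B P) : ∀ᵐ ω ∂P, ∀ c : ℝ, ∃ t, B t ω < c := by
  have key : ∀ c : ℝ, P.real {ω | ∀ s, c ≤ B s ω} ≤ 0 := by
    intro c
    set r : Finset ℝ≥0 → ℝ := fun I => P.real {ω | ∀ s ∈ I, c ≤ B s ω} with hr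
    set θ := (gaussianReal 0 1).real (Set.Ioi (-1)) with hθ
    have hθ0 : 0 ≤ θ := measureReal_nonneg
    have hθ1 : θ < 1 := gaussianReal_real_Ioi_neg_one_lt_one
    have hbdd : BddBelow (Set.range r) := ⟨0, by
      rintro _ ⟨I, rfl⟩
      exact measureReal_nonneg⟩
    -- The infimum over finite time sets is at most `θ < 1` times itself, hence not positive. Finite
    -- sets avoid any appeal to path continuity.
    have h1 : ∀ I, (⨅ J, r J) ≤ r I * θ := fun I => le_of_forall_pos_le_add fun δ hδ => by
      obtain ⟨J, hJ⟩ := exists_measureReal_forall_ge_le hB c I hδ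
      exact (ciInf_le hbdd J).trans hJ
    have h2 : (⨅ J, r J) ≤ (⨅ J, r J) * θ := by
      rw [Real.iInf_mul_of_nonneg hθ0]
      exact le_ciInf h1
    have h3 : (⨅ J, r J) ≤ 0 := by nlinarith
    refine le_trans (le_ciInf fun I => ?_) h3
    exact measureReal_mono fun ω hω s _ => hω s
  have h : ∀ n : ℕ, ∀ᵐ ω ∂P, ∃ t, B t ω < -(n : ℝ) := fun n => by
    have h0 : P.real {ω | ∀ s, -(n : ℝ) ≤ B s ω} = 0 := le_antisymm (key _) measureReal_nonneg
    rw [measureReal_eq_zero_iff] at h0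
    filter_upwards [measure_eq_zero_iff_ae_notMem.1 h0] with ω hω
    simpa using hω
  filter_upwards [ae_all_iff.2 h] with ω hω c
  obtain ⟨n, hn⟩ := exists_nat_gt (-c)
  obtain ⟨t, ht⟩ := hω n
  exact ⟨t, by linarith⟩

end Unbounded

/-! ### Local solutions on the nonnegative time axis -/

section HalfLineSolution

variable {a a' x x' : ℝ} {f : ℝ≥0 → ℝ} {ζ : ℝ≥0∞} {Y Y' : ℝ≥0 → ℝ}

lemma IsHalfLineSolution.isPathSolution (h : IsHalfLineSolution a x f ζ Y) {t : ℝ≥0}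
    (ht : (t : ℝ≥0∞) < ζ) :
    IsPathSolution (halfLineDrift a) x (fun s => f s.toNNReal) t (fun s => Y s.toNNReal) := by
  have hmem : ∀ s ∈ Set.Icc (0 : ℝ) t, ((s.toNNReal : ℝ≥0) : ℝ≥0∞) < ζ := fun s hs =>
    lt_of_le_of_lt (by exact_mod_cast Real.toNNReal_le_iff_le_coe.2 hs.2) ht
  refine ⟨h.continuousOn.comp continuous_real_toNNReal.continuousOn hmem,
    h.intervalIntegrable t ht, fun s hs => ?_⟩
  have := h.eq s.toNNReal (hmem s hs)
  rwa [Real.coe_toNNReal s hs.1] at this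

lemma IsHalfLineSolution.le (h : IsHalfLineSolution a x f ζ Y)
    (h' : IsHalfLineSolution a' x' f ζ Y') (ha : 0 < a) (haa' : a ≤ a') (hx : x ≤ x') {t : ℝ≥0}
    (ht : (t : ℝ≥0∞) < ζ) : Y t ≤ Y' t := by
  have hpos : ∀ᵐ s : ℝ, s ∈ Set.Icc (0 : ℝ) t → 0 < Y' s.toNNReal := by
    filter_upwards [h'.ae_pos] with s hs hmem
    refine hs hmem.1 (lt_of_le_of_lt ?_ ht)
    exact_mod_cast hmem.2
  simpa using halfLine_comparison ha haa' hx (h.isPathSolution ht) (h'.isPathSolution ht) hpos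
    t ⟨t.2, le_rfl⟩

lemma IsHalfLineSolution.mono_time {ζ' : ℝ≥0∞} (h : IsHalfLineSolution a x f ζ Y) (hζ : ζ' ≤ ζ) :
    IsHalfLineSolution a x f ζ' Y where
  continuousOn := h.continuousOn.mono fun _ ht => lt_of_lt_of_le ht hζ
  nonneg t ht := h.nonneg t (ht.trans_le hζ)
  ae_pos := h.ae_pos.mono fun _ hs h0 hlt => hs h0 (hlt.trans_le hζ)
  intervalIntegrable t ht := h.intervalIntegrable t (ht.trans_le hζ)
  eq t ht := h.eq t (ht.trans_le hζ)

lemma IsGlobalSolution.isHalfLineSolution {Z : ℝ → ℝ}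
    (hZ : IsGlobalSolution a x (fun s => f s.toNNReal) Z) :
    IsHalfLineSolution a x f ⊤ (fun t => Z t) := by
  have hsol : ∀ t : ℝ≥0, IsPathSolution (halfLineDrift a) x (fun s => f s.toNNReal) t
      (fun s => Z s.toNNReal) := fun t =>
    (hZ.isPathSolution t t.2).congr t.2
      (fun s hs => by rw [Real.coe_toNNReal s hs.1]) (fun s hs => by rw [Real.coe_toNNReal s hs.1])
  refine ⟨?_, fun t _ => hZ.nonneg t t.2, ?_, fun t _ => (hsol t).intervalIntegrable, fun t _ => ?_⟩
  · refine Continuous.continuousOn (continuous_iff_continuousAt.2 fun t => ?_)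
    have hc : ContinuousOn (fun s : ℝ≥0 => Z s) (Set.Iio (t + 1)) :=
      (hZ.isPathSolution (t + 1) (by positivity)).continuousOn.comp
        NNReal.continuous_coe.continuousOn fun s hs => ⟨s.2, by exact_mod_cast (le_of_lt hs)⟩
    exact hc.continuousAt (Iio_mem_nhds (lt_add_one t))
  · filter_upwards [hZ.ae_pos] with s hs h0 _
    rw [Real.coe_toNNReal s h0]
    exact hs h0
  · simpa using (hsol t).eq t ⟨t.2, le_rfl⟩

/-- Solutions decrease to a limit as the parameter decreases to `0`. -/
lemma exists_tendsto_of_isHalfLineSolution {Y : ℝ → ℝ≥0 → ℝ}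
    (hY : ∀ a, 0 < a → IsHalfLineSolution a x f ⊤ (Y a)) (t : ℝ≥0) :
    ∃ l, Tendsto (fun a => Y a t) (𝓝[>] 0) (𝓝 l) := by
  have hmono : MonotoneOn (fun a => Y a t) (Set.Ioi 0) := fun a ha a' ha' haa' =>
    (hY a ha).le (hY a' ha') ha haa' le_rfl ENNReal.coe_lt_top
  refine ⟨_, hmono.tendsto_nhdsGT ⟨0, ?_⟩⟩
  rintro _ ⟨a, ha, rfl⟩
  exact (hY a ha).nonneg t ENNReal.coe_lt_top

end HalfLineSolution

/-! ### Adaptedness -/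

/-- Solutions are measurable functionals of the driving path up to the present time. -/
def solutionFunctional (a x : ℝ) (t : ℝ≥0) (p : Set.Iic t → ℝ) : ℝ :=
  limsup (fun m : ℕ => limsup (fun j : ℕ => limsup (fun n : ℕ =>
    eulerFunctional a (1 / ((j : ℝ) + 1)) (x + 1 / ((m : ℝ) + 1)) (t / n) t n p)
    atTop) atTop) atTop

lemma measurable_solutionFunctional (a x : ℝ) (t : ℝ≥0) : Measurable (solutionFunctional a x t) :=
  Measurable.limsup fun _ => Measurable.limsup fun _ => Measurable.limsup fun _ =>
    measurable_eulerFunctional _ _ _ _ _ _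

/-- On a non-hitting path all three upper limits are limits. For fixed `m` the start is positive and
the solution stays above some `ε` on `[0, t]`, so the Euler limit in `n` is exact once the freezing
level `1 / (j + 1)` is below `ε`. The outer limit lowers the starting point to `x`. -/
lemma IsNonHittingPath.exists_isGlobalSolution_eq {a x : ℝ} {f : ℝ≥0 → ℝ}
    (hf : IsNonHittingPath fun s => f s.toNNReal) (ha : 0 < a) (hx : 0 ≤ x) :
    ∃ Z, IsGlobalSolution a x (fun s => f s.toNNReal) Z ∧
      ∀ t : ℝ≥0, Z t = solutionFunctional a x t fun s => f s := by
  obtain ⟨Z, hZ, hlim⟩ := hf.exists_isGlobalSolution ha hx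
  refine ⟨Z, hZ, fun t => ?_⟩
  have hpos : ∀ m : ℕ, 0 < x + 1 / ((m : ℝ) + 1) := fun m => by positivity
  choose X hX using fun m : ℕ => hf.exists_forall_isPosSolution ha (hpos m)
  have hm : ∀ m : ℕ, Tendsto (fun j : ℕ => limsup (fun n : ℕ =>
      eulerFunctional a (1 / ((j : ℝ) + 1)) (x + 1 / ((m : ℝ) + 1)) (t / n) t n fun s => f s)
      atTop) atTop (𝓝 (X m t)) := by
    intro m
    obtain ⟨ε, hε, hle⟩ := (hX m t t.2).exists_le t.2
    refine tendsto_const_nhds.congr' ?_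
    filter_upwards [tendsto_one_div_add_atTop_nhds_zero_nat.eventually (gt_mem_nhds hε)] with j hj
    have h1 := (hX m t t.2).tendsto_halfLineEuler ha hf.apply_zero t.2
      (by positivity : 0 < 1 / ((j : ℝ) + 1)) hj hle
    rw [← h1.limsup_eq]
    congr 1
    ext n
    refine halfLineEuler_eq_eulerFunctional f ?_
    rcases Nat.eq_zero_or_pos n with rfl | hn
    · simp
    · exact (mul_div_cancel₀ t (by positivity)).le
  have h2 := hlim X hX t t.2
  rw [← h2.limsup_eq]
  unfold solutionFunctional
  congr 1
  ext m
  exact (hm m).limsup_eq.symm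

open Classical in
/-- The solution of the half-line equation driven by `f`, when there is one on `[0, ∞)`. -/
def halfLineFlow (a x : ℝ) (f : ℝ≥0 → ℝ) (t : ℝ≥0) : ℝ :=
  if h : ∃ Z, IsGlobalSolution a x (fun s => f s.toNNReal) Z then h.choose t else 0

section halfLineFlow

variable {a x : ℝ} {f : ℝ≥0 → ℝ}

lemma halfLineFlow_eq (ha : 0 < a) {Z : ℝ → ℝ}
    (hZ : IsGlobalSolution a x (fun s => f s.toNNReal) Z) (t : ℝ≥0) :
    halfLineFlow a x f t = Z t := by
  have h : ∃ Z, IsGlobalSolution a x (fun s => f s.toNNReal) Z := ⟨Z, hZ⟩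
  rw [halfLineFlow, dif_pos h]
  exact le_antisymm (h.choose_spec.le hZ ha le_rfl le_rfl t.2)
    (hZ.le h.choose_spec ha le_rfl le_rfl t.2)

end halfLineFlow

end

theorem propositionA {Ω : Type*} [MeasurableSpace Ω] (P : Measure Ω) [IsProbabilityMeasure P]
    (B : ℝ≥0 → Ω → ℝ) (hB : IsBrownianReal B P) :
    -- for every sample point: comparison in the initial value and in the parameter, and
    -- existence of the limit
    (∀ ω : Ω,
      (∀ (a a' x y : ℝ) (ζ : ℝ≥0∞) (Y Y' : ℝ≥0 → ℝ), 0 < a → a ≤ a' → 0 ≤ x → x ≤ y →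
        IsHalfLineSolution a x (fun t => B t ω) ζ Y →
        IsHalfLineSolution a' y (fun t => B t ω) ζ Y' →
        ∀ t : ℝ≥0, (t : ℝ≥0∞) < ζ → Y t ≤ Y' t) ∧
      (∀ x : ℝ, 0 ≤ x → ∀ Y : ℝ → ℝ≥0 → ℝ,
        (∀ a : ℝ, 0 < a → IsHalfLineSolution a x (fun t => B t ω) ⊤ (Y a)) →
        ∀ t : ℝ≥0, ∃ l : ℝ, Tendsto (fun a => Y a t) (𝓝[>] 0) (𝓝 l))) ∧
    ∃ X : ℝ → ℝ → ℝ≥0 → Ω → ℝ,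
      -- the solutions are adapted to the completed Brownian filtration
      (∀ a x : ℝ, 0 < a → 0 ≤ x → ∀ t : ℝ≥0, ∃ F : (Set.Iic t → ℝ) → ℝ,
        Measurable F ∧ X a x t =ᵐ[P] fun ω => F (fun s => B s ω)) ∧
      ∀ᵐ ω ∂P,
        -- they solve the equation for all times
        (∀ a x : ℝ, 0 < a → 0 ≤ x →
          IsHalfLineSolution a x (fun t => B t ω) ⊤ (fun t => X a x t ω)) ∧
        -- every local solution agrees with them
        (∀ a x : ℝ, 0 < a → 0 ≤ x → ∀ (ζ : ℝ≥0∞) (Y : ℝ≥0 → ℝ),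
          IsHalfLineSolution a x (fun t => B t ω) ζ Y →
          ∀ t : ℝ≥0, (t : ℝ≥0∞) < ζ → Y t = X a x t ω) ∧
        -- they never hit `0`
        (∀ a x : ℝ, 0 < a → 0 ≤ x → ∀ t : ℝ≥0, (0 < x ∨ 0 < t) → 0 < X a x t ω) ∧
        -- they are increasing in the initial value and decrease when `a` decreases
        (∀ a : ℝ, 0 < a → ∀ t : ℝ≥0, StrictMonoOn (fun x => X a x t ω) (Set.Ici 0)) ∧
        (∀ x : ℝ, 0 ≤ x → ∀ t : ℝ≥0, MonotoneOn (fun a => X a x t ω) (Set.Ioi 0)) ∧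
        -- they converge to the Skorohod solution, which is not `|x + B|`
        (∀ x : ℝ, 0 ≤ x →
          (∃! p : (ℝ≥0 → ℝ) × (ℝ≥0 → ℝ), IsSkorohodSolution x (fun t => B t ω) p.1 p.2) ∧
          ∀ g h : ℝ≥0 → ℝ, IsSkorohodSolution x (fun t => B t ω) g h →
            (∀ t : ℝ≥0, Tendsto (fun a => X a x t ω) (𝓝[>] 0) (𝓝 (g t))) ∧
            ∃ t : ℝ≥0, g t ≠ |x + B t ω|) := by
  refine ⟨fun ω => ⟨fun a a' x y ζ Y Y' ha haa' _ hxy hY hY' t ht => hY.le hY' ha haa' hxy ht,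
    fun x _ Y hY t => exists_tendsto_of_isHalfLineSolution hY t⟩,
    fun a x t ω => halfLineFlow a x (fun s => B s ω) t, fun a x ha hx t =>
      ⟨solutionFunctional a x t, measurable_solutionFunctional a x t, ?_⟩, ?_⟩
  · filter_upwards [ae_isNonHittingPath hB] with ω hω
    obtain ⟨Z, hZ, hZt⟩ := hω.exists_isGlobalSolution_eq (f := fun s => B s ω) ha hx
    rw [halfLineFlow_eq (f := fun s => B s ω) ha hZ, hZt]
  · filter_upwards [ae_isNonHittingPath hB, hB.cont, hB.eval_zero_ae_eq_zero,
      ae_forall_exists_lt hB.toIsPreBrownianReal,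
      ae_forall_exists_lt hB.toIsPreBrownianReal.neg] with ω hω hcont h0 hbelow habove
    set f : ℝ≥0 → ℝ := fun s => B s ω with hf
    have habove' : ∀ c : ℝ, ∃ t, c < f t := fun c => by
      obtain ⟨t, ht⟩ := habove (-c)
      exact ⟨t, by simpa using ht⟩
    have hglob : ∀ a x, 0 < a → 0 ≤ x → ∃ Z, IsGlobalSolution a x (fun s => f s.toNNReal) Z :=
      fun a x ha hx => (hω.exists_isGlobalSolution ha hx).imp fun _ h => h.1
    choose! Z hZ using hglob
    have hflow : ∀ a x, 0 < a → 0 ≤ x → ∀ t : ℝ≥0, halfLineFlow a x f t = Z a x t :=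
      fun a x ha hx t => halfLineFlow_eq ha (hZ a x ha hx) t
    have hsol : ∀ a x, 0 < a → 0 ≤ x →
        IsHalfLineSolution a x f ⊤ (fun t => halfLineFlow a x f t) := fun a x ha hx => by
      simp_rw [hflow a x ha hx]
      exact (hZ a x ha hx).isHalfLineSolution
    have hlim : ∀ x, 0 ≤ x → ∀ g h, IsSkorohodSolution x f g h → ∀ t : ℝ≥0,
        Tendsto (fun a => halfLineFlow a x f t) (𝓝[>] 0) (𝓝 (g t)) := fun x hx g h hgh t => by
      refine (hgh.tendsto_globalSolution hcont (fun a ha => hZ a x ha hx) t).congr' ?_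
      filter_upwards [self_mem_nhdsWithin] with a ha using (hflow a x ha hx t).symm
    refine ⟨hsol, fun a x ha hx ζ Y hY t ht => ?_, fun a x ha hx t hxt => ?_,
      fun a ha t x hx y hy hxy => ?_, fun x hx t a ha a' ha' haa' => ?_, fun x hx => ⟨?_, ?_⟩⟩
    · have hX := (hsol a x ha hx).mono_time (ζ' := ζ) le_top
      exact le_antisymm (hY.le hX ha le_rfl le_rfl ht) (hX.le hY ha le_rfl le_rfl ht)
    · rw [hflow a x ha hx]
      exact hω.pos ha (hZ a x ha hx) t.2 (by simpa using hxt)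
    · simp only [hflow a x ha hx, hflow a y ha hy]
      exact hω.lt ha hxy (hZ a x ha hx) (hZ a y ha hy) t.2
    · exact (hsol a x ha hx).le (hsol a' x ha' hx) ha haa' le_rfl ENNReal.coe_lt_top
    · obtain ⟨g, h, hgh⟩ := exists_isSkorohodSolution hx hcont h0
      refine ⟨(g, h), hgh, fun p hp => ?_⟩
      -- Uniqueness for the Skorohod problem comes for free: the reflected path of any solution is
      -- the limit of the same flow, and the equation then determines the reflection term.
      have hg : p.1 = g := funext fun t =>
        tendsto_nhds_unique (hlim x hx _ _ hp t) (hlim x hx g h hgh t)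
      refine Prod.ext hg (funext fun t => ?_)
      have h1 := hp.eq t
      have h2 := hgh.eq t
      rw [hg] at h1
      simp only
      linarith
    · exact fun g h hgh => ⟨hlim x hx g h hgh, hgh.exists_ne_abs hcont hbelow habove'⟩
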